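/- Let $A$ be a set and $\theta\subseteq A\times A$ a symmetric antireflexive relation, and let $\mathbb M(A,\theta)=\langle A\mid ab=ba,\ (a,b)\in\theta\rangle$ be the free partially commutative monoid. For $t\in\mathbb M(A,\theta)$ let $\mathrm{Alph}(t)$ be the set of letters occurring in $t$ and $IA(t)=\{z\in A: t\in z\,\mathbb M(A,\theta)\}$. For $X\subseteq\mathbb M(A,\theta)$ put $\theta_X=\{(x,y)\in X^2:\mathrm{Alph}(x)\times\mathrm{Alph}(y)\subseteq\theta\}$ and let $\langle X\rangle$ be the submonoid generated by $X$; $X$ is a *partially commutative code* if the canonical morphism $\mathbb M(X,\theta_X)\to\mathbb M(A,\theta)$, whose image is $\langle X\rangle$, is injective, and then $\langle X\rangle$ is identified with $\mathbb M(X,\theta_X)$. A *factorization* of a monoid $M$ is a family $(M_i)_{i\in J}$ of submonoids, indexed by a totally ordered set $J$, such that every $m\in M\setminus\{1\}$ has a unique decomposition $m=m_1\cdots m_n$ with $m_k\in M_{i_k}\setminus\{1\}$ and $i_1<\dots<i_n$. For factorizations write $(M_i)_{i\in J}\preceq(M'_j)_{j\in J'}$ (the second is finer) if $J'$ is an ordered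 sum $\sum_{i\in J}J_i$ of non-empty intervals such that $(M'_j)_{j\in J_i}$ is a factorization of $M_i$ for each $i\in J$. The restriction of a factorization $\mathcal G=(M_k)_{k\in K}$ to a submonoid $M'$ is the subfamily $\mathcal G|_{M'}=(M_k)_{k\in K,\,M_k\subseteq M'}$. A sequence $(Y_1,\dots,Y_n)$ of subsets of $\mathbb M(A,\theta)$ denotes the family $(\langle Y_1\rangle,\dots,\langle Y_n\rangle)$. For $B\subseteq A$ and $Z=A\setminus B$ let $\beta_Z(B)=\{zw: z\in Z,\ w\in\langle B\rangle,\ IA(zw)=\{z\}\}$. If $\beta_Z(B)$ is a partially commutative code, $B$ is called a *transitively factorizing subalphabet* of $(A,\theta)$ and $(B,\beta_Z(B))$ a *transitive bisection* of $\mathbb M(A,\theta)$. A (finite) *transitive factorization* of $\mathbb M(A,\theta)$ is a factorization that is obtained from the one-term sequence $(A)$ by finitely many (possibly no) steps, each of which replaces a term $X$ of the sequence by the two consecutive terms $B,\ \beta_{X\setminus B}(B)$, where $(B,\beta_{X\setminus B}(B))$ is a transitive bisection of $\mathbb M(X,\theta_X)=\langle X\rangle$. For a partially commutative code $Y$, transitive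 factorizations of $\mathbb M(Y,\theta_Y)=\langle Y\rangle$ are obtained in the same way from $(Y)$. **Proposition.** Let $\mathcal F=(Y_i)_{i\in J}$ and $\mathcal F'=(Y'_j)_{j\in J'}$ be two finite transitive factorizations of $\mathbb M(A,\theta)$, and let $\mathcal G$ be a factorization of $\mathbb M(A,\theta)$ (not necessarily finite or transitive) with $\mathcal F\preceq\mathcal G$ and $\mathcal F'\preceq\mathcal G$. Then there is a finite transitive factorization $\mathcal G'$ of $\mathbb M(A,\theta)$ such that (i) $\mathcal F\preceq\mathcal G'\preceq\mathcal G$ and $\mathcal F'\preceq\mathcal G'\preceq\mathcal G$; (ii) for each $j\in J$, $\mathcal G'|_{\langle Y_j\rangle}$ is a finite transitive factorization of $\mathbb M(Y_j,\theta_{Y_j})$; (iii) for each $j\in J'$, $\mathcal G'|_{\langle Y'_j\rangle}$ is a finite transitive factorization of $\mathbb M(Y'_j,\theta_{Y'_j})$. -/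

import Mathlib

/-- The defining relations `ab = ba`, for `(a, b) ∈ θ`. -/
def commRel {A : Type*} (θ : A → A → Prop) (u v : FreeMonoid A) : Prop :=
  ∃ a b, θ a b ∧ u = FreeMonoid.of a * FreeMonoid.of b ∧ v = FreeMonoid.of b * FreeMonoid.of a

/-- The free partially commutative monoid `M(A, θ)`; its elements are called traces. -/
abbrev Trace {A : Type*} (θ : A → A → Prop) : Type _ := PresentedMonoid (commRel θ)

namespace Trace

variable {A : Type*} (θ : A → A → Prop)

/-- A letter, as a trace. -/
abbrev letter (a : A) : Trace θ := PresentedMonoid.of (commRel θ) a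

/-- The alphabet `A`, as a subset of `M(A, θ)`. -/
def letters : Set (Trace θ) := Set.range (letter θ)

variable {θ}

/-- `Alph t`: the letters that occur in the trace `t`. -/
def alph (t : Trace θ) : Set A := {a | ∃ u v : Trace θ, t = u * letter θ a * v}

/-- `IA t`: the letters that can stand first in the trace `t`. -/
def IA (t : Trace θ) : Set A := {z | ∃ w : Trace θ, t = letter θ z * w}

/-- The independence relation `θ_X = {(x, y) ∈ X² | Alph x × Alph y ⊆ θ}` on `X ⊆ M(A, θ)`. -/
def indep (X : Set (Trace θ)) (x y : X) : Prop :=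
  ∀ a ∈ alph (x : Trace θ), ∀ b ∈ alph (y : Trace θ), θ a b

theorem letter_commute {a b : A} (h : θ a b) : Commute (letter θ a) (letter θ b) :=
  PresentedMonoid.mk_eq_mk_of_rel (rels := commRel θ) ⟨a, b, h, rfl, rfl⟩

/-- Every trace is a product of letters that occur in it. -/
theorem mem_closure_alph (t : Trace θ) : t ∈ Submonoid.closure (letter θ '' alph t) := by
  suffices H : ∀ s u v : Trace θ, t = u * s * v → s ∈ Submonoid.closure (letter θ '' alph t) from
    H t 1 1 (by simp)
  intro s
  have hs : s ∈ Submonoid.closure (Set.range (letter θ)) := by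
    rw [PresentedMonoid.closure_range_of]; trivial
  induction hs using Submonoid.closure_induction with
  | mem x hx =>
    rintro u v h
    obtain ⟨a, rfl⟩ := hx
    exact Submonoid.subset_closure ⟨a, ⟨u, v, h⟩, rfl⟩
  | one => intro _ _ _; exact one_mem _
  | mul x y _ _ ihx ihy =>
    intro u v h
    exact mul_mem (ihx u (y * v) (by rw [h]; simp only [mul_assoc]))
      (ihy (u * x) v (by rw [h]; simp only [mul_assoc]))

theorem commute_of_indep {X : Set (Trace θ)} {x y : X} (h : indep X x y) :
    Commute (x : Trace θ) (y : Trace θ) := by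
  have key : ∀ a ∈ alph (x : Trace θ), Commute (letter θ a) (y : Trace θ) := by
    intro a ha
    have hy : (y : Trace θ) ∈ Submonoid.centralizer {letter θ a} := by
      refine (Submonoid.closure_le.2 ?_) (mem_closure_alph (y : Trace θ))
      rintro _ ⟨b, hb, rfl⟩
      exact Submonoid.mem_centralizer_iff.2 fun g hg => by
        rw [Set.mem_singleton_iff.1 hg]; exact (letter_commute (h a ha b hb)).eq
    exact Submonoid.mem_centralizer_iff.1 hy _ rfl
  have hx : (x : Trace θ) ∈ Submonoid.centralizer {(y : Trace θ)} := by
    refine (Submonoid.closure_le.2 ?_) (mem_closure_alph (x : Trace θ))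
    rintro _ ⟨a, ha, rfl⟩
    exact Submonoid.mem_centralizer_iff.2 fun g hg => by
      rw [Set.mem_singleton_iff.1 hg]; exact (key a ha).symm.eq
  exact (Submonoid.mem_centralizer_iff.1 hx _ rfl).symm

/-- The canonical morphism `M(X, θ_X) → M(A, θ)`, with image `⟨X⟩`. -/
def subHom (X : Set (Trace θ)) : Trace (indep X) →* Trace θ :=
  PresentedMonoid.lift (fun x : X => (x : Trace θ)) (by
    rintro _ _ ⟨x, y, h, rfl, rfl⟩
    simpa using (commute_of_indep h).eq)

/-- `X` is a partially commutative code: `⟨X⟩` is free partially commutative with independence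
alphabet `(X, θ_X)`. -/
def IsPCCode (X : Set (Trace θ)) : Prop := Function.Injective (subHom X)

variable (θ) in
/-- `β_Z(B) = {zw | z ∈ Z, w ∈ M(B, θ_B), IA(zw) = {z}}`, where `Z = A - B`. -/
def beta (B : Set A) : Set (Trace θ) :=
  {t | ∃ z ∉ B, ∃ w ∈ Submonoid.closure (letter θ '' B), t = letter θ z * w ∧ IA t = {z}}

variable (θ) in
/-- `B ⊆ A` is a transitively factorizing subalphabet of `(A, θ)`. The bisection
`(B, β_Z(B))` of `M(A, θ)` is then called transitive. -/
def IsTFSA (B : Set A) : Prop := IsPCCode (beta θ B)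

end Trace

section Factorization

variable {M : Type*} [Monoid M]

/-- `l = [(i₁, m₁), …, (iₙ, mₙ)]` is a decomposition `m = m₁ ⋯ mₙ` along the ordered family `N`:
`i₁ < ⋯ < iₙ` and `mₖ ∈ N iₖ - {1}`. -/
def IsDecomposition {J : Type*} [LinearOrder J] (N : J → Submonoid M) (m : M)
    (l : List (J × M)) : Prop :=
  (l.map Prod.fst).Pairwise (· < ·) ∧ (∀ p ∈ l, p.2 ∈ N p.1 ∧ p.2 ≠ 1) ∧
    (l.map Prod.snd).prod = m

/-- The ordered family `N` of submonoids is a factorization of the submonoid `P` of `M`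
(a factorization of `M` itself for `P = ⊤`). -/
def IsFactorization {J : Type*} [LinearOrder J] (P : Submonoid M) (N : J → Submonoid M) : Prop :=
  (∀ i, N i ≤ P) ∧ ∀ m ∈ P, m ≠ 1 → ∃! l : List (J × M), IsDecomposition N m l

/-- `N ≼ N'`: the factorization `N'` is finer than (or equal to) `N`. The fibres of the monotone
surjection `φ` are the (nonempty) intervals `J_i` in `J' = ∑_{i ∈ J} J_i`. -/
def FinerThan {J J' : Type*} [LinearOrder J] [LinearOrder J']
    (N : J → Submonoid M) (N' : J' → Submonoid M) : Prop :=
  ∃ φ : J' → J, Monotone φ ∧ Function.Surjective φ ∧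
    ∀ i, IsFactorization (N i) (fun k : {k : J' // φ k = i} => N' k)

/-- The ordered family of submonoids `⟨Y₁⟩, …, ⟨Yₙ⟩` denoted by a sequence `[Y₁, …, Yₙ]` of
generating sets. -/
def factors (L : List (Set M)) (i : Fin L.length) : Submonoid M := Submonoid.closure (L.get i)

open Classical in
/-- The restriction of `[Y₁, …, Yₙ]` to the submonoid `P`: keep those `Yᵢ` with `⟨Yᵢ⟩ ⊆ P`. -/
noncomputable def restrictTo (L : List (Set M)) (P : Submonoid M) : List (Set M) :=
  L.filter (fun Y => Submonoid.closure Y ≤ P)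

end Factorization

namespace Trace

variable {A : Type*} {θ : A → A → Prop}

/-- The sequences obtained from `[Y]` by composing with finitely many (possibly no) transitive
bisections: at each step a factor `X` is replaced by the two members `B`, `β_{X - B}(B)` of a
transitive bisection of `M(X, θ_X)`, read in `M(A, θ)` through the canonical morphism. -/
inductive IsComposedOfTransitiveBisections (Y : Set (Trace θ)) : List (Set (Trace θ)) → Prop
  | trivial : IsComposedOfTransitiveBisections Y [Y]
  | comp (L₁ L₂ : List (Set (Trace θ))) (X : Set (Trace θ)) (B : Set X) :
      IsComposedOfTransitiveBisections Y (L₁ ++ X :: L₂) → IsTFSA (indep X) B →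
      IsComposedOfTransitiveBisections Y
        (L₁ ++ (Subtype.val '' B) :: (subHom X '' beta (indep X) B) :: L₂)

/-- `L` is a (finite) transitive factorization of `M(Y, θ_Y)`, realized as the submonoid `⟨Y⟩`
of `M(A, θ)`, for a partially commutative code `Y` of `M(A, θ)`; for `Y = letters θ` this is a
transitive factorization of `M(A, θ)`. -/
def IsTransitiveFactorization (Y : Set (Trace θ)) (L : List (Set (Trace θ))) : Prop :=
  IsFactorization (Submonoid.closure Y) (factors L) ∧ IsComposedOfTransitiveBisections Y L

end Trace

/-! Label every factor of a factorization coarser than `G` by the set of indices of `K` whose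
members of `G` make it up. A sequence of bisections that produces `F` or `F'` then becomes a binary
tree (`SegTree`), in which an inner node carries the union of the labels of its two children,
because ⟨Y⟩ = ⟨B⟩⟨β(B)⟩. Both trees have the root `letters θ` with label `Set.univ`, and `G'` is
read off the leaves of a common refinement.

To refine two bisections (B, β(B)) and (B', β(B')) of one code Y, note that the labels of B and B'
are initial segments of the label of Y, hence nested, say with B ⊆ B'. Then (B, β_{B'}(B), β(B'))
refines both: B cuts B' into B and β_{B'}(B), while β_{B'}(B) cuts β(B) with right member exactly
β(B') (`IsPCCode.betaIn_betaIn`). Moreover β_{B'}(B) is a code, being a subset of the code β(B).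
Induction on trees does the rest: `SegTree.exists_refines_bisection` pushes a bisection through a
tree, and `SegTree.exists_common_refinement` merges two trees.

The identity for β(B') rests on Levi's lemma for traces and on the description of ⟨β(B)⟩ as the set
of traces with no first letter in B (`mem_closure_beta`). It is proved for letters and carried to an
arbitrary code along the injective `subHom`. -/

namespace Trace

/-! ### Letters, content and length of traces. -/

section Basic

variable {A : Type*} {θ : A → A → Prop}

/-- The morphism out of `M(A, θ)` determined by the images of the letters. -/
def liftHom {M : Type*} [Monoid M] (f : A → M) (h : ∀ a b, θ a b → f a * f b = f b * f a) :
    Trace θ →* M :=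
  PresentedMonoid.lift f (by
    rintro _ _ ⟨a, b, hab, rfl, rfl⟩
    simpa using h a b hab)

@[simp]
theorem liftHom_letter {M : Type*} [Monoid M] (f : A → M)
    (h : ∀ a b, θ a b → f a * f b = f b * f a) (a : A) : liftHom f h (letter θ a) = f a := rfl

@[simp]
theorem subHom_letter (X : Set (Trace θ)) (x : X) : subHom X (letter (indep X) x) = x := rfl

theorem hom_ext {M : Type*} [Monoid M] {f g : Trace θ →* M}
    (h : ∀ a, f (letter θ a) = g (letter θ a)) : f = g :=
  PresentedMonoid.ext _ h

theorem induction_letter {p : Trace θ → Prop} (t : Trace θ) (one : p 1)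
    (mul : ∀ a u, p u → p (letter θ a * u)) : p t := by
  refine Submonoid.induction_of_closure_eq_top_left
    (PresentedMonoid.closure_range_of (commRel θ)) t one ?_
  rintro _ ⟨a, rfl⟩ u hu
  exact mul a u hu

/-- The multiset of letters of a trace. -/
def content : Trace θ →* Multiplicative (Multiset A) :=
  liftHom (fun a => Multiplicative.ofAdd {a}) (fun _ _ _ => mul_comm _ _)

/-- The length of a trace. -/
def length (t : Trace θ) : ℕ := (content t).toAdd.card

theorem content_letter (a : A) : (content (letter θ a)).toAdd = {a} := rfl

@[simp]
theorem length_one : length (1 : Trace θ) = 0 := rfl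

@[simp]
theorem length_letter (a : A) : length (letter θ a) = 1 := rfl

@[simp]
theorem length_mul (u v : Trace θ) : length (u * v) = length u + length v := by
  simp [length]

theorem mem_alph {a : A} {t : Trace θ} : a ∈ alph t ↔ a ∈ (content t).toAdd := by
  constructor
  · rintro ⟨u, v, rfl⟩
    simp [content_letter]
  · induction t using induction_letter with
    | one => intro h; simp at h
    | mul b u ih =>
      intro h
      rw [map_mul, toAdd_mul, Multiset.mem_add, content_letter, Multiset.mem_singleton] at h
      rcases h with rfl | h
      · exact ⟨1, u, by simp⟩
      · obtain ⟨v, w, rfl⟩ := ih h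
        exact ⟨letter θ b * v, w, by simp only [mul_assoc]⟩

@[simp]
theorem alph_one : alph (1 : Trace θ) = ∅ := by
  ext a; simp [mem_alph]

@[simp]
theorem alph_letter (a : A) : alph (letter θ a) = {a} := by
  ext b; simp [mem_alph, content_letter]

@[simp]
theorem alph_mul (u v : Trace θ) : alph (u * v) = alph u ∪ alph v := by
  ext a; simp [mem_alph]

theorem letter_injective : Function.Injective (letter θ) := by
  intro a b h
  have := congrArg alph h
  simpa using this

theorem eq_one_of_mul_eq_one {u v : Trace θ} (h : u * v = 1) : u = 1 := by
  have hl : length u = 0 := by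
    have := congrArg length h
    simp at this; exact this.1
  induction u using induction_letter with
  | one => rfl
  | mul a u _ => simp at hl

theorem letter_ne_one (a : A) : letter θ a ≠ 1 := fun h => by
  have := congrArg length h
  simp at this

theorem mem_closure_letter {B : Set A} {t : Trace θ} :
    t ∈ Submonoid.closure (letter θ '' B) ↔ alph t ⊆ B := by
  constructor
  · intro h
    induction h using Submonoid.closure_induction with
    | mem x hx => obtain ⟨b, hb, rfl⟩ := hx; simpa using hb
    | one => simp
    | mul x y _ _ hx hy => simpa using ⟨hx, hy⟩
  · exact fun h => Submonoid.closure_mono (Set.image_mono h) (mem_closure_alph t)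

theorem closure_letters : Submonoid.closure (letters θ) = ⊤ :=
  PresentedMonoid.closure_range_of (commRel θ)

theorem exists_letter_of_ne_one {t : Trace θ} (h : t ≠ 1) : ∃ a u, t = letter θ a * u := by
  induction t using induction_letter with
  | one => exact (h rfl).elim
  | mul a u _ => exact ⟨a, u, rfl⟩

end Basic

/-! ### Levi's lemma, cancellation and the elimination of a subalphabet. -/

section Levi

variable {A : Type*} {θ : A → A → Prop}

open Classical in
/-- The action of a letter on pairs (trace, its left quotient by the letter `a`). -/
noncomputable def quotStep (θ : A → A → Prop) (a x : A) :
    Function.End (Trace θ × Option (Trace θ)) := fun p =>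
  (letter θ x * p.1,
    if x = a then some p.1 else if θ x a then p.2.map (letter θ x * ·) else none)

/-- The action of traces on pairs (trace, its left quotient by the letter `a`). -/
noncomputable def quotHom (hsymm : ∀ a b, θ a b → θ b a) (hirrefl : ∀ a, ¬ θ a a) (a : A) :
    Trace θ →* Function.End (Trace θ × Option (Trace θ)) :=
  liftHom (quotStep θ a) (by
    intro x y hxy
    have hc := (letter_commute hxy).eq
    have hyx := hsymm _ _ hxy
    have hne : x ≠ y := by rintro rfl; exact hirrefl _ hxy
    -- Independent letters must act by commuting maps. Irreflexivity of `θ` excludes the clash in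
    -- which both letters equal `a`.
    funext ⟨m, r⟩
    refine Prod.ext ?_ ?_
    · change letter θ x * (letter θ y * m) = letter θ y * (letter θ x * m)
      rw [← mul_assoc, hc, mul_assoc]
    · simp only [Function.End.mul_def, Function.comp, quotStep]
      by_cases hx : x = a
      · subst hx
        simp [hne.symm, hyx]
      · by_cases hy : y = a
        · subst hy
          simp [hne, hxy]
        · by_cases h1 : θ x a <;> by_cases h2 : θ y a <;> simp [hx, hy, h1, h2]
          congr 1
          funext s
          rw [hc])

theorem quotHom_fst (hsymm : ∀ a b, θ a b → θ b a) (hirrefl : ∀ a, ¬ θ a a) (a : A)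
    (t : Trace θ) : (quotHom hsymm hirrefl a t (1, none)).1 = t := by
  induction t using induction_letter with
  | one => rw [map_one]; rfl
  | mul b u ih =>
    rw [map_mul]
    change letter θ b * (quotHom hsymm hirrefl a u (1, none)).1 = _
    rw [ih]

open Classical in
theorem quotHom_snd (hsymm : ∀ a b, θ a b → θ b a) (hirrefl : ∀ a, ¬ θ a a) (a b : A)
    (u : Trace θ) : (quotHom hsymm hirrefl a (letter θ b * u) (1, none)).2 =
      if b = a then some u else if θ b a then
        (quotHom hsymm hirrefl a u (1, none)).2.map (letter θ b * ·) else none := by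
  conv_rhs => rw [← quotHom_fst hsymm hirrefl a u]
  rw [map_mul]
  simp only [quotHom_fst]
  change (if b = a then some (quotHom hsymm hirrefl a u (1, none)).1 else _) = _
  rw [quotHom_fst]

theorem eq_mul_of_quotHom (hsymm : ∀ a b, θ a b → θ b a) (hirrefl : ∀ a, ¬ θ a a) (a : A)
    (t u : Trace θ) (h : (quotHom hsymm hirrefl a t (1, none)).2 = some u) :
    t = letter θ a * u := by
  induction t using induction_letter generalizing u with
  | one => rw [map_one] at h; cases h
  | mul b v ih =>
    rw [quotHom_snd] at h
    split_ifs at h with h1 h2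
    · subst h1; rw [Option.some.inj h]
    · obtain ⟨w, hw, rfl⟩ := Option.map_eq_some_iff.1 h
      rw [ih w hw, ← mul_assoc, ← mul_assoc, (letter_commute h2).eq]

theorem letter_mul_cancel (hsymm : ∀ a b, θ a b → θ b a) (hirrefl : ∀ a, ¬ θ a a) {a : A}
    {u v : Trace θ} (h : letter θ a * u = letter θ a * v) : u = v := by
  have := congrArg (fun t => (quotHom hsymm hirrefl a t (1, none)).2) h
  simpa only [quotHom_snd, if_true, Option.some.injEq] using this

theorem letter_levi (hsymm : ∀ a b, θ a b → θ b a) (hirrefl : ∀ a, ¬ θ a a) {a b : A}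
    {u v : Trace θ} (h : letter θ a * u = letter θ b * v) (hab : a ≠ b) :
    θ a b ∧ ∃ w, u = letter θ b * w ∧ v = letter θ a * w := by
  -- Compare left quotients by `a`: on the left it is `u`, while on the right it exists only if `b`
  -- commutes past `a`, and then starts with `b`.
  have h' := congrArg (fun t => (quotHom hsymm hirrefl a t (1, none)).2) h
  simp only [quotHom_snd, if_true, if_neg hab.symm] at h'
  split_ifs at h' with hb
  obtain ⟨w, hw, rfl⟩ := Option.map_eq_some_iff.1 h'.symm
  exact ⟨hsymm _ _ hb, w, rfl, eq_mul_of_quotHom _ _ _ _ _ hw⟩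

theorem IA_mul (hsymm : ∀ a b, θ a b → θ b a) (hirrefl : ∀ a, ¬ θ a a) {u v : Trace θ} {c : A}
    (h : c ∈ IA (u * v)) : c ∈ IA u ∨ c ∈ IA v := by
  induction u using induction_letter with
  | one => right; simpa using h
  | mul a u ih =>
    by_cases hac : a = c
    · exact Or.inl ⟨u, by rw [hac]⟩
    · obtain ⟨w, hw⟩ := h
      rw [mul_assoc] at hw
      obtain ⟨hθ, x, hx, -⟩ := letter_levi hsymm hirrefl hw hac
      rcases ih ⟨x, hx⟩ with ⟨y, rfl⟩ | h
      · exact Or.inl ⟨letter θ a * y, by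
          rw [← mul_assoc, ← mul_assoc, (letter_commute hθ).eq]⟩
      · exact Or.inr h

theorem IA_mul_left {u v : Trace θ} {c : A} (h : c ∈ IA u) : c ∈ IA (u * v) := by
  obtain ⟨w, rfl⟩ := h
  exact ⟨w * v, mul_assoc _ _ _⟩

theorem IA_subset_alph (t : Trace θ) : IA t ⊆ alph t := by
  rintro a ⟨w, rfl⟩; simp

theorem IA_subset_of_closure_beta (hsymm : ∀ a b, θ a b → θ b a) (hirrefl : ∀ a, ¬ θ a a)
    {B : Set A} {t : Trace θ} (h : t ∈ Submonoid.closure (beta θ B)) {c : A} (hc : c ∈ IA t) :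
    c ∉ B := by
  induction h using Submonoid.closure_induction with
  | mem x hx =>
    obtain ⟨z, hz, w, -, -, hIA⟩ := hx
    rw [hIA] at hc
    rwa [Set.mem_singleton_iff.1 hc]
  | one => simpa using IA_subset_alph _ hc
  | mul x y _ _ hx hy =>
    rcases IA_mul hsymm hirrefl hc with h | h
    · exact hx h
    · exact hy h

/-- A first letter of `z * b` other than `z` is independent of `z` and divides `b`, by Levi. Pulling
such letters to the front shortens `b`, and the process stops when `z` is the only first letter. -/
theorem exists_beta_mul (hsymm : ∀ a b, θ a b → θ b a) (hirrefl : ∀ a, ¬ θ a a) {B : Set A}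
    {z : A} (hz : z ∉ B) (b : Trace θ) (hb : alph b ⊆ B) :
    ∃ b₁ b₂ : Trace θ, alph b₁ ⊆ B ∧ letter θ z * b = b₁ * (letter θ z * b₂) ∧
      letter θ z * b₂ ∈ beta θ B := by
  obtain ⟨n, hn⟩ : ∃ n, length b < n := ⟨_, Nat.lt_succ_self _⟩
  induction n generalizing b with
  | zero => omega
  | succ n ih =>
    by_cases h : IA (letter θ z * b) = {z}
    · exact ⟨1, b, by simp, by simp, z, hz, b, mem_closure_letter.2 hb, rfl, h⟩
    · have : ∃ c ∈ IA (letter θ z * b), z ≠ c := by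
        by_contra! hcon
        exact h (Set.eq_singleton_iff_unique_mem.2 ⟨⟨b, rfl⟩, fun c hc => (hcon c hc).symm⟩)
      obtain ⟨c, ⟨m, hm⟩, hzc⟩ := this
      obtain ⟨hθ, w, rfl, rfl⟩ := letter_levi hsymm hirrefl hm hzc
      simp only [alph_mul, alph_letter, Set.union_subset_iff, Set.singleton_subset_iff] at hb
      obtain ⟨b₁, b₂, h1, h2, h3⟩ := ih w hb.2 (by simp at hn; omega)
      refine ⟨letter θ c * b₁, b₂, ?_, ?_, h3⟩
      · simpa [Set.insert_subset_iff] using ⟨hb.1, h1⟩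
      · rw [hm, h2, mul_assoc]

/-- The elimination of `B`: `M(A, θ) = ⟨B⟩ ⟨β_Z(B)⟩`. -/
theorem exists_bisection (hsymm : ∀ a b, θ a b → θ b a) (hirrefl : ∀ a, ¬ θ a a) (B : Set A)
    (m : Trace θ) : ∃ b t : Trace θ, alph b ⊆ B ∧ t ∈ Submonoid.closure (beta θ B) ∧ m = b * t := by
  induction m using induction_letter with
  | one => exact ⟨1, 1, by simp, one_mem _, by simp⟩
  | mul a u ih =>
    obtain ⟨b, t, hb, ht, rfl⟩ := ih
    by_cases ha : a ∈ B
    · exact ⟨letter θ a * b, t, by simpa [Set.insert_subset_iff] using ⟨ha, hb⟩, ht,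
        (mul_assoc _ _ _).symm⟩
    · obtain ⟨b₁, b₂, h1, h2, h3⟩ := exists_beta_mul hsymm hirrefl ha b hb
      exact ⟨b₁, (letter θ a * b₂) * t, h1, mul_mem (Submonoid.subset_closure h3) ht, by
        rw [← mul_assoc, h2, mul_assoc]⟩

/-- In the decomposition `m = b * t` a nontrivial `b` would put a letter of `B` first. Membership
thus becomes a condition on first letters only. -/
theorem mem_closure_beta (hsymm : ∀ a b, θ a b → θ b a) (hirrefl : ∀ a, ¬ θ a a) {B : Set A}
    {m : Trace θ} : m ∈ Submonoid.closure (beta θ B) ↔ ∀ c ∈ IA m, c ∉ B := by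
  refine ⟨fun h c hc => IA_subset_of_closure_beta hsymm hirrefl h hc, fun h => ?_⟩
  obtain ⟨b, t, hb, ht, rfl⟩ := exists_bisection hsymm hirrefl B m
  by_cases hb1 : b = 1
  · simpa [hb1] using ht
  · obtain ⟨a, u, rfl⟩ := exists_letter_of_ne_one hb1
    refine absurd (hb ?_) (h a (IA_mul_left ⟨u, rfl⟩))
    simp

/-- A first letter of an element of `⟨β_Z(B)⟩` is the first letter of a left factor in
`β_Z(B)`. -/
theorem exists_beta_prefix (hsymm : ∀ a b, θ a b → θ b a) (hirrefl : ∀ a, ¬ θ a a) {B : Set A}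
    {t : Trace θ} (ht : t ∈ Submonoid.closure (beta θ B)) {c : A} (hc : c ∈ IA t) :
    ∃ b u : Trace θ, alph b ⊆ B ∧ letter θ c * b ∈ beta θ B ∧
      u ∈ Submonoid.closure (beta θ B) ∧ t = (letter θ c * b) * u := by
  have hI := (mem_closure_beta hsymm hirrefl).1 ht
  obtain ⟨m, rfl⟩ := hc
  obtain ⟨b, u, hb, hu, rfl⟩ := exists_bisection hsymm hirrefl B m
  have hcB : c ∉ B := hI c ⟨_, rfl⟩
  obtain ⟨b₁, b₂, h1, h2, h3⟩ := exists_beta_mul hsymm hirrefl hcB b hb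
  -- A letter beginning `b₁` would be a first letter of the whole trace lying in `B`.
  have hb1 : b₁ = 1 := by
    by_contra hne
    obtain ⟨a, v, rfl⟩ := exists_letter_of_ne_one hne
    refine hI a ?_ (h1 (by simp))
    rw [← mul_assoc, h2]
    exact IA_mul_left (IA_mul_left ⟨v, rfl⟩)
  rw [hb1, one_mul] at h2
  exact ⟨b, u, hb, h2 ▸ h3, hu, (mul_assoc _ _ _).symm⟩

end Levi

end Trace

/-! ### An intrinsic form of β, suited to transport along morphisms. -/

/-- `β_{X - B}(B)`, described inside an arbitrary monoid for a subset `B` of a set `X`. -/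
def betaIn {M : Type*} [Monoid M] (X B : Set M) : Set M :=
  {t | ∃ z ∈ X, z ∉ B ∧ ∃ w ∈ Submonoid.closure B, t = z * w ∧
    ∀ x ∈ X, ∀ u ∈ Submonoid.closure X, t = x * u → x = z}

/-- Because `betaIn` refers only to products in the monoid, it passes through any injective
morphism. This moves results about letters to arbitrary codes. -/
theorem betaIn_image {M N : Type*} [Monoid M] [Monoid N] (f : M →* N)
    (hf : Function.Injective f) (X B : Set M) :
    betaIn (f '' X) (f '' B) = f '' betaIn X B := by
  ext t
  constructor
  · rintro ⟨_, ⟨z, hz, rfl⟩, hzB, w, hw, rfl, h⟩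
    rw [← MonoidHom.map_mclosure] at hw h
    obtain ⟨w, hw, rfl⟩ := hw
    refine ⟨z * w, ⟨z, hz, fun h' => hzB ⟨z, h', rfl⟩, w, hw, rfl, fun x hx u hu he => ?_⟩,
      map_mul _ _ _⟩
    exact hf (h (f x) ⟨x, hx, rfl⟩ (f u) ⟨u, hu, rfl⟩ (by rw [← map_mul, ← map_mul, he]))
  · rintro ⟨_, ⟨z, hz, hzB, w, hw, rfl, h⟩, rfl⟩
    refine ⟨f z, ⟨z, hz, rfl⟩, ?_, f w, ?_, map_mul _ _ _, ?_⟩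
    · rintro ⟨z', hz', he⟩
      exact hzB (hf he ▸ hz')
    · rw [← MonoidHom.map_mclosure]
      exact ⟨w, hw, rfl⟩
    · rintro _ ⟨x, hx, rfl⟩ u hu he
      rw [← MonoidHom.map_mclosure] at hu
      obtain ⟨u, hu, rfl⟩ := hu
      rw [← map_mul] at he
      rw [h x hx u hu (hf he)]

theorem closure_betaIn_le {M : Type*} [Monoid M] {X B : Set M} (hB : B ⊆ X) :
    Submonoid.closure (betaIn X B) ≤ Submonoid.closure X := by
  rw [Submonoid.closure_le]
  rintro _ ⟨z, hz, -, w, hw, rfl, -⟩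
  exact mul_mem (Submonoid.subset_closure hz) (Submonoid.closure_mono hB hw)

namespace Trace

/-! ### β for subalphabets of the letters. -/

section Letters

variable {A : Type*} {θ : A → A → Prop}

theorem betaIn_letters (B : Set A) : betaIn (letters θ) (letter θ '' B) = beta θ B := by
  ext t
  constructor
  · rintro ⟨_, ⟨z, rfl⟩, hzB, w, hw, rfl, h⟩
    refine ⟨z, fun hz => hzB ⟨z, hz, rfl⟩, w, hw, rfl, ?_⟩
    refine Set.eq_singleton_iff_unique_mem.2 ⟨⟨w, rfl⟩, ?_⟩
    rintro c ⟨u, hu⟩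
    exact letter_injective (h _ ⟨c, rfl⟩ u (by rw [closure_letters]; trivial) hu)
  · rintro ⟨z, hz, w, hw, rfl, h⟩
    refine ⟨_, ⟨z, rfl⟩, ?_, w, hw, rfl, ?_⟩
    · rintro ⟨z', hz', he⟩
      exact hz (letter_injective he ▸ hz')
    · rintro _ ⟨c, rfl⟩ u - hu
      have : c ∈ IA (letter θ z * w) := ⟨u, hu⟩
      rw [h] at this
      rw [Set.mem_singleton_iff.1 this]

/-- Factors of a trace over `B'` are again over `B'`, so first letters are the same whether computed
over `B'` or over `A`. -/
theorem betaIn_subalphabet {B B' : Set A} (hB : B ⊆ B') :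
    betaIn (letter θ '' B') (letter θ '' B) = beta θ B ∩ {t | alph t ⊆ B'} := by
  ext t
  constructor
  · rintro ⟨_, ⟨z, hz, rfl⟩, hzB, w, hw, rfl, h⟩
    have hw' := mem_closure_letter.1 hw
    have hal : alph (letter θ z * w) ⊆ B' := by
      rw [alph_mul, alph_letter]
      exact Set.union_subset (by simpa) (hw'.trans hB)
    refine ⟨⟨z, fun hz => hzB ⟨z, hz, rfl⟩, w, hw, rfl, ?_⟩, hal⟩
    refine Set.eq_singleton_iff_unique_mem.2 ⟨⟨w, rfl⟩, ?_⟩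
    rintro c ⟨u, hu⟩
    rw [hu, alph_mul, alph_letter, Set.union_subset_iff, Set.singleton_subset_iff] at hal
    exact letter_injective (h _ ⟨c, hal.1, rfl⟩ u (mem_closure_letter.2 hal.2) hu)
  · rintro ⟨⟨z, hz, w, hw, rfl, h⟩, hal⟩
    rw [Set.mem_ofPred_eq, alph_mul, alph_letter, Set.union_subset_iff,
      Set.singleton_subset_iff] at hal
    refine ⟨_, ⟨z, hal.1, rfl⟩, ?_, w, hw, rfl, ?_⟩
    · rintro ⟨z', hz', he⟩
      exact hz (letter_injective he ▸ hz')
    · rintro _ ⟨c, -, rfl⟩ u - hu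
      have : c ∈ IA (letter θ z * w) := ⟨u, hu⟩
      rw [h] at this
      rw [Set.mem_singleton_iff.1 this]

theorem mem_closure_beta_inter {B B' : Set A} {t : Trace θ}
    (ht : t ∈ Submonoid.closure (beta θ B)) (hal : alph t ⊆ B') :
    t ∈ Submonoid.closure (beta θ B ∩ {t | alph t ⊆ B'}) := by
  induction ht using Submonoid.closure_induction with
  | mem x hx => exact Submonoid.subset_closure ⟨hx, hal⟩
  | one => exact one_mem _
  | mul x y _ _ hx hy =>
    rw [alph_mul, Set.union_subset_iff] at hal
    exact mul_mem (hx hal.1) (hy hal.2)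

theorem closure_beta_inter (B B' : Set A) :
    Submonoid.closure (beta θ B ∩ {t | alph t ⊆ B'}) =
      Submonoid.closure (letter θ '' B') ⊓ Submonoid.closure (beta θ B) := by
  apply le_antisymm
  · rw [Submonoid.closure_le]
    rintro t ⟨h1, h2⟩
    exact ⟨mem_closure_letter.2 h2, Submonoid.subset_closure h1⟩
  · rintro t ⟨h1, h2⟩
    exact mem_closure_beta_inter h2 (mem_closure_letter.1 h1)

end Letters

/-! ### Partially commutative codes and nested bisections. -/

section Code

variable {A : Type*} {θ : A → A → Prop}

theorem mrange_subHom (X : Set (Trace θ)) :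
    MonoidHom.mrange (subHom X) = Submonoid.closure X := by
  rw [MonoidHom.mrange_eq_map, ← closure_letters, MonoidHom.map_mclosure]
  congr 1
  ext x
  constructor
  · rintro ⟨_, ⟨y, rfl⟩, rfl⟩
    exact y.2
  · exact fun hx => ⟨_, ⟨⟨x, hx⟩, rfl⟩, rfl⟩

theorem subHom_image_letter (X : Set (Trace θ)) (B : Set X) :
    subHom X '' (letter (indep X) '' B) = Subtype.val '' B := by
  rw [Set.image_image]
  rfl

theorem subHom_image_letters (X : Set (Trace θ)) : subHom X '' letters (indep X) = X := by
  rw [letters, ← Set.range_comp]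
  exact Subtype.range_val

theorem alph_subHom (X : Set (Trace θ)) (t : Trace (indep X)) :
    alph (subHom X t) = ⋃ x ∈ alph t, alph (x : Trace θ) := by
  induction t using induction_letter with
  | one => simp
  | mul a u ih =>
    rw [map_mul, alph_mul, ih, alph_mul, Set.biUnion_union]
    simp

theorem indep_symm (hsymm : ∀ a b, θ a b → θ b a) (X : Set (Trace θ)) (x y : X)
    (h : indep X x y) : indep X y x := fun a ha b hb => hsymm _ _ (h b hb a ha)

theorem IsPCCode.one_notMem {X : Set (Trace θ)} (hX : IsPCCode X) : (1 : Trace θ) ∉ X :=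
  fun h => letter_ne_one (⟨1, h⟩ : X) (hX (by simp))

/-- Elements of a code are nontrivial, so they contain a letter, which is not independent of itself.
Hence the results on (A, θ) apply to (X, θ_X). -/
theorem IsPCCode.indep_irrefl (hirrefl : ∀ a, ¬ θ a a) {X : Set (Trace θ)} (hX : IsPCCode X)
    (x : X) : ¬ indep X x x := by
  intro h
  have hx : (x : Trace θ) ≠ 1 := fun h1 => hX.one_notMem (h1 ▸ x.2)
  obtain ⟨a, u, hu⟩ := exists_letter_of_ne_one hx
  have ha : a ∈ alph (x : Trace θ) := by rw [hu]; simp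
  exact hirrefl a (h a ha a ha)

theorem IsPCCode.eq_empty_of_closure {X : Set (Trace θ)} (hX : IsPCCode X)
    (h : Submonoid.closure X = ⊥) : X = ∅ := by
  rw [Set.eq_empty_iff_forall_notMem]
  intro x hx
  have : x ∈ Submonoid.closure X := Submonoid.subset_closure hx
  rw [h, Submonoid.mem_bot] at this
  exact hX.one_notMem (this ▸ hx)

open Classical in
-- Erasing the letters outside `S` is a retraction of the morphism induced by the inclusion `S ⊆ X`,
-- which is therefore injective.
theorem IsPCCode.mono {X S : Set (Trace θ)} (hX : IsPCCode X) (hS : S ⊆ X) : IsPCCode S := by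
  let i : Trace (indep S) →* Trace (indep X) :=
    liftHom (fun s => letter (indep X) ⟨s, hS s.2⟩) (fun a b h =>
      (letter_commute (θ := indep X) (a := ⟨a, hS a.2⟩) (b := ⟨b, hS b.2⟩) h).eq)
  let r : Trace (indep X) →* Trace (indep S) :=
    liftHom (fun x => if h : (x : Trace θ) ∈ S then letter (indep S) ⟨x, h⟩ else 1) (by
      intro a b h
      by_cases ha : (a : Trace θ) ∈ S <;> by_cases hb : (b : Trace θ) ∈ S <;> simp only [ha, hb,
        dif_pos, dif_neg, not_false_eq_true, one_mul, mul_one]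
      exact (letter_commute (θ := indep S) (a := ⟨a, ha⟩) (b := ⟨b, hb⟩) h).eq)
  have h1 : r.comp i = MonoidHom.id _ := hom_ext (fun a => by simp [i, r])
  have h2 : (subHom X).comp i = subHom S := hom_ext (fun a => by simp [i])
  have hi : Function.Injective i :=
    Function.LeftInverse.injective (g := r) (fun t => DFunLike.congr_fun h1 t)
  have : ⇑(subHom S) = subHom X ∘ i := by rw [← h2]; rfl
  rw [IsPCCode, this]
  exact hX.comp hi

theorem isPCCode_empty : IsPCCode (∅ : Set (Trace θ)) := by
  intro u v _
  induction u using induction_letter with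
  | one =>
    induction v using induction_letter with
    | one => rfl
    | mul a _ _ => exact a.2.elim
  | mul a _ _ => exact a.2.elim

theorem isPCCode_letters : IsPCCode (letters θ) := by
  let r : Trace θ →* Trace (indep (letters θ)) :=
    liftHom (fun a => letter (indep (letters θ)) ⟨letter θ a, a, rfl⟩) (fun a b h =>
      (letter_commute (by intro c hc d hd; simp at hc hd; rwa [hc, hd])).eq)
  have h1 : r.comp (subHom (letters θ)) = MonoidHom.id _ :=
    hom_ext (by rintro ⟨_, a, rfl⟩; simp [r])
  exact Function.LeftInverse.injective (g := r) (fun t => DFunLike.congr_fun h1 t)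

/-- A partially commutative code of `M(X, θ_X)` is one of `M(A, θ)`, and conversely. -/
theorem IsPCCode.image_iff {X : Set (Trace θ)} (hX : IsPCCode X) (S : Set (Trace (indep X))) :
    IsPCCode (subHom X '' S) ↔ IsPCCode S := by
  have hiff : ∀ s t : S, indep S s t ↔
      indep (subHom X '' S) ⟨subHom X s, s, s.2, rfl⟩ ⟨subHom X t, t, t.2, rfl⟩ := by
    intro s t
    simp only [indep, alph_subHom, Set.mem_iUnion]
    constructor
    · rintro h a ⟨x, hx, ha⟩ b ⟨y, hy, hb⟩
      exact h x hx y hy a ha b hb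
    · intro h x hx y hy a ha b hb
      exact h a ⟨x, hx, ha⟩ b ⟨y, hy, hb⟩
  choose! g hg hfg using fun (y : Trace θ) (hy : y ∈ subHom X '' S) => hy
  have hgf : ∀ s : Trace (indep X), s ∈ S → g (subHom X s) = s := fun s hs =>
    hX (hfg _ ⟨s, hs, rfl⟩)
  let F : Trace (indep S) →* Trace (indep (subHom X '' S)) :=
    liftHom (fun s => letter _ ⟨subHom X s, s, s.2, rfl⟩)
      (fun a b h => (letter_commute ((hiff a b).1 h)).eq)
  let G : Trace (indep (subHom X '' S)) →* Trace (indep S) :=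
    liftHom (fun y => letter _ ⟨g y, hg _ y.2⟩) (fun a b h => (letter_commute (by
      rw [hiff]
      convert h using 1
      · exact Subtype.ext (hfg _ a.2)
      · exact Subtype.ext (hfg _ b.2))).eq)
  have h1 : G.comp F = MonoidHom.id _ := hom_ext (fun s => by simp [G, F, hgf _ s.2])
  have h2 : F.comp G = MonoidHom.id _ := hom_ext (fun s => by simp [G, F, hfg _ s.2])
  have h3 : (subHom (subHom X '' S)).comp F = (subHom X).comp (subHom S) :=
    hom_ext (fun s => by simp [F])
  have hF : Function.Bijective F := Function.bijective_iff_has_inverse.2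
    ⟨G, fun t => DFunLike.congr_fun h1 t, fun t => DFunLike.congr_fun h2 t⟩
  have h4 : ⇑(subHom (subHom X '' S)) ∘ F = subHom X ∘ subHom S := congrArg DFunLike.coe h3
  rw [IsPCCode, IsPCCode, ← Function.Injective.of_comp_iff' _ hF, h4,
    Function.Injective.of_comp_iff hX]

theorem IsPCCode.levi (hsymm : ∀ a b, θ a b → θ b a) (hirrefl : ∀ a, ¬ θ a a)
    {X : Set (Trace θ)} (hX : IsPCCode X) {x y u v : Trace θ} (hx : x ∈ X) (hy : y ∈ X)
    (hu : u ∈ Submonoid.closure X) (hv : v ∈ Submonoid.closure X) (h : x * u = y * v)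
    (hxy : x ≠ y) : ∀ a ∈ alph x, ∀ b ∈ alph y, θ a b := by
  rw [← mrange_subHom] at hu hv
  obtain ⟨u, rfl⟩ := hu
  obtain ⟨v, rfl⟩ := hv
  have h' : letter (indep X) ⟨x, hx⟩ * u = letter (indep X) ⟨y, hy⟩ * v := hX (by simpa using h)
  exact (letter_levi (indep_symm hsymm X) (hX.indep_irrefl hirrefl) h'
    (fun he => hxy (congrArg Subtype.val he))).1

/-- The heart of the refinement argument. Left divisors of a trace in ⟨β(B)⟩ that belong to β(B) are
matched with its first letters: each first letter begins such a divisor, and since β(B) is a code,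
two distinct ones have independent alphabets and so cannot begin with the same letter. -/
theorem betaIn_beta (hsymm : ∀ a b, θ a b → θ b a) (hirrefl : ∀ a, ¬ θ a a) {B B' : Set A}
    (hB : B ⊆ B') (hT : IsPCCode (beta θ B)) :
    betaIn (beta θ B) (beta θ B ∩ {t | alph t ⊆ B'}) = beta θ B' := by
  ext t
  constructor
  · rintro ⟨_, ⟨a, ha, b, hb, rfl, hab⟩, hzC, w, hw, rfl, h⟩
    rw [closure_beta_inter] at hw
    have hbB := mem_closure_letter.1 hb
    have hwB := mem_closure_letter.1 hw.1
    have haB' : a ∉ B' := fun h' => hzC ⟨⟨a, ha, b, hb, rfl, hab⟩, by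
      simpa [Set.insert_subset_iff] using ⟨h', hbB.trans hB⟩⟩
    refine ⟨a, haB', b * w, mem_closure_letter.2 ?_, mul_assoc _ _ _, ?_⟩
    · simpa using ⟨hbB.trans hB, hwB⟩
    · refine Set.eq_singleton_iff_unique_mem.2 ⟨⟨b * w, mul_assoc _ _ _⟩, fun c hc => ?_⟩
      have ht : (letter θ a * b) * w ∈ Submonoid.closure (beta θ B) :=
        mul_mem (Submonoid.subset_closure ⟨a, ha, b, hb, rfl, hab⟩) hw.2
      obtain ⟨d, u, -, hx, hu, he⟩ := exists_beta_prefix hsymm hirrefl ht hc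
      have hxe := h _ hx u hu he
      have hcI : c ∈ IA (letter θ a * b) := ⟨d, hxe.symm⟩
      rwa [hab] at hcI
  · rintro ⟨a, ha, w, hw, rfl, haw⟩
    have hwB := mem_closure_letter.1 hw
    -- The only first letter is `a`, which is outside `B'` and hence outside `B`.
    have ht : letter θ a * w ∈ Submonoid.closure (beta θ B) := by
      rw [mem_closure_beta hsymm hirrefl, haw]
      rintro c rfl h
      exact ha (hB h)
    obtain ⟨d, u, hd, hx, hu, he⟩ := exists_beta_prefix hsymm hirrefl ht (c := a) ⟨w, rfl⟩
    have hw' : w = d * u := by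
      rw [mul_assoc] at he
      exact letter_mul_cancel hsymm hirrefl he
    have huB : alph u ⊆ B' := by
      rw [hw', alph_mul] at hwB
      exact Set.subset_union_right.trans hwB
    refine ⟨letter θ a * d, hx, ?_, u, mem_closure_beta_inter hu huB, he, ?_⟩
    · rintro ⟨-, h⟩
      exact ha (h (by simp))
    · intro x hxT v hv hxv
      by_contra hne
      have hxI : x ∈ beta θ B := hxT
      obtain ⟨z, -, y, -, rfl, -⟩ := hxI
      have hz : z ∈ IA (letter θ a * w) := ⟨y * v, by rw [hxv, mul_assoc]⟩
      rw [haw] at hz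
      obtain rfl := Set.mem_singleton_iff.1 hz
      -- Levi in the code `beta θ B`: two distinct left divisors would be independent, yet both
      -- contain `z`.
      exact hirrefl z (hT.levi hsymm hirrefl hxT hx hv hu (hxv.symm.trans he) hne z (by simp) z
        (by simp))

theorem exists_image_letter {X B : Set (Trace θ)} (hB : B ⊆ X) :
    B = subHom X '' (letter (indep X) '' {x | (x : Trace θ) ∈ B}) := by
  rw [subHom_image_letter]
  ext b
  simp only [Set.mem_image, Set.mem_ofPred_eq, Subtype.exists, exists_and_right, exists_eq_right]
  exact ⟨fun h => ⟨hB h, h⟩, fun ⟨_, h⟩ => h⟩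

theorem IsPCCode.image_beta {X : Set (Trace θ)} (hX : IsPCCode X) (B : Set X) :
    subHom X '' beta (indep X) B = betaIn X (Subtype.val '' B) := by
  rw [← betaIn_letters, ← betaIn_image _ hX, subHom_image_letters, subHom_image_letter]

theorem IsPCCode.isTFSA_iff {X : Set (Trace θ)} (hX : IsPCCode X) (B : Set X) :
    IsTFSA (indep X) B ↔ IsPCCode (betaIn X (Subtype.val '' B)) := by
  rw [IsTFSA, ← hX.image_iff, hX.image_beta]

theorem IsPCCode.exists_bisection (hsymm : ∀ a b, θ a b → θ b a) (hirrefl : ∀ a, ¬ θ a a)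
    {X B : Set (Trace θ)} (hX : IsPCCode X) (hB : B ⊆ X) {m : Trace θ}
    (hm : m ∈ Submonoid.closure X) :
    ∃ b ∈ Submonoid.closure B, ∃ t ∈ Submonoid.closure (betaIn X B), m = b * t := by
  rw [← mrange_subHom] at hm
  obtain ⟨m, rfl⟩ := hm
  obtain ⟨b, t, hb, ht, rfl⟩ := Trace.exists_bisection (indep_symm hsymm X)
    (hX.indep_irrefl hirrefl) {x : X | (x : Trace θ) ∈ B} m
  refine ⟨subHom X b, ?_, subHom X t, ?_, map_mul _ _ _⟩
  · rw [exists_image_letter hB, ← MonoidHom.map_mclosure]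
    exact ⟨b, mem_closure_letter.2 hb, rfl⟩
  · have := hX.image_beta {x : X | (x : Trace θ) ∈ B}
    rw [← subHom_image_letter, ← exists_image_letter hB] at this
    rw [← this, ← MonoidHom.map_mclosure]
    exact ⟨t, ht, rfl⟩

/-- Elements of a code act as letters of a free partially commutative monoid. This turns inclusions
of generated submonoids into inclusions of generating sets. -/
theorem IsPCCode.mem_of_mem_closure {X B : Set (Trace θ)} (hX : IsPCCode X) (hB : B ⊆ X)
    {x : Trace θ} (hx : x ∈ X) (h : x ∈ Submonoid.closure B) : x ∈ B := by
  rw [exists_image_letter hB, ← MonoidHom.map_mclosure] at h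
  obtain ⟨t, ht, he⟩ := h
  have : t = letter (indep X) ⟨x, hx⟩ := hX (by simpa using he)
  have h' := mem_closure_letter.1 ht
  rw [this, alph_letter, Set.singleton_subset_iff] at h'
  exact h'

section Nested

variable {X B B' : Set (Trace θ)}

theorem IsPCCode.betaIn_nested (hX : IsPCCode X) (hB : B ⊆ B') (hB' : B' ⊆ X) :
    betaIn B' B = subHom X '' (beta (indep X) {x : X | (x : Trace θ) ∈ B} ∩
      {t | alph t ⊆ {x : X | (x : Trace θ) ∈ B'}}) := by
  have h : {x : X | (x : Trace θ) ∈ B} ⊆ {x : X | (x : Trace θ) ∈ B'} := fun x hx => hB hx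
  rw [← betaIn_subalphabet h, ← betaIn_image _ hX,
    ← exists_image_letter hB', ← exists_image_letter (hB.trans hB')]

theorem IsPCCode.betaIn_eq (hX : IsPCCode X) (hB : B ⊆ X) :
    betaIn X B = subHom X '' beta (indep X) {x : X | (x : Trace θ) ∈ B} := by
  rw [hX.image_beta, ← subHom_image_letter, ← exists_image_letter hB]

theorem IsPCCode.betaIn_subset (hX : IsPCCode X) (hB : B ⊆ B') (hB' : B' ⊆ X) :
    betaIn B' B ⊆ betaIn X B := by
  rw [hX.betaIn_nested hB hB', hX.betaIn_eq (hB.trans hB')]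
  exact Set.image_mono Set.inter_subset_left

theorem IsPCCode.closure_betaIn (hX : IsPCCode X) (hB : B ⊆ B') (hB' : B' ⊆ X) :
    Submonoid.closure (betaIn B' B) =
      Submonoid.closure B' ⊓ Submonoid.closure (betaIn X B) := by
  rw [hX.betaIn_nested hB hB', hX.betaIn_eq (hB.trans hB'), ← MonoidHom.map_mclosure,
    closure_beta_inter, Submonoid.map_inf _ _ _ hX, MonoidHom.map_mclosure,
    MonoidHom.map_mclosure, ← exists_image_letter hB']

/-- For `B ⊆ B'`, the bisection of `β(B)` by its elements over `B'` has right member `β(B')`. -/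
theorem IsPCCode.betaIn_betaIn (hsymm : ∀ a b, θ a b → θ b a) (hirrefl : ∀ a, ¬ θ a a)
    (hX : IsPCCode X) (hB : B ⊆ B') (hB' : B' ⊆ X) (hT : IsPCCode (betaIn X B)) :
    betaIn (betaIn X B) (betaIn B' B) = betaIn X B' := by
  rw [hX.betaIn_eq (hB.trans hB'), hX.image_iff] at hT
  have h : {x : X | (x : Trace θ) ∈ B} ⊆ {x : X | (x : Trace θ) ∈ B'} := fun x hx => hB hx
  rw [hX.betaIn_nested hB hB', hX.betaIn_eq (hB.trans hB'), hX.betaIn_eq hB', betaIn_image _ hX,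
    betaIn_beta (indep_symm hsymm X) (hX.indep_irrefl hirrefl) h hT]

end Nested

end Code

end Trace

/-! ### Decompositions along an ordered family and submonoids cut out by sets of indices. -/

section Segments

variable {M : Type*} [Monoid M] {K : Type*} [LinearOrder K] {G : K → Submonoid M}

/-- Every element has exactly one decomposition along `G`. -/
def UniqueDec (G : K → Submonoid M) : Prop := ∀ m, ∃! l, IsDecomposition G m l

/-- `P` consists of the elements whose decomposition along `G` is supported in `S`. -/
def IsSegment (G : K → Submonoid M) (S : Set K) (P : Submonoid M) : Prop :=
  ∀ m, m ∈ P ↔ ∃ l, IsDecomposition G m l ∧ ∀ p ∈ l, p.1 ∈ S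

theorem IsDecomposition.nil : IsDecomposition G 1 [] := by simp [IsDecomposition]

theorem IsDecomposition.singleton {k : K} {x : M} (hx : x ∈ G k) (h1 : x ≠ 1) :
    IsDecomposition G x [(k, x)] := by simp [IsDecomposition, hx, h1]

theorem IsDecomposition.append {m m' : M} {l l' : List (K × M)} (h : IsDecomposition G m l)
    (h' : IsDecomposition G m' l') (hlt : ∀ p ∈ l, ∀ q ∈ l', p.1 < q.1) :
    IsDecomposition G (m * m') (l ++ l') := by
  obtain ⟨h1, h2, h3⟩ := h
  obtain ⟨h1', h2', h3'⟩ := h'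
  refine ⟨?_, ?_, by simp [h3, h3']⟩
  · rw [List.map_append, List.pairwise_append]
    refine ⟨h1, h1', ?_⟩
    simp only [List.mem_map]
    rintro _ ⟨p, hp, rfl⟩ _ ⟨q, hq, rfl⟩
    exact hlt p hp q hq
  · simp only [List.mem_append]
    rintro p (hp | hp)
    exacts [h2 p hp, h2' p hp]

theorem isDecomposition_cons {m : M} {p : K × M} {l : List (K × M)} :
    IsDecomposition G m (p :: l) ↔ p.2 ∈ G p.1 ∧ p.2 ≠ 1 ∧ (∀ q ∈ l, p.1 < q.1) ∧
      ∃ m', IsDecomposition G m' l ∧ m = p.2 * m' := by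
  constructor
  · rintro ⟨h1, h2, h3⟩
    rw [List.map_cons, List.pairwise_cons] at h1
    refine ⟨(h2 p (by simp)).1, (h2 p (by simp)).2,
      fun q hq => h1.1 _ (List.mem_map_of_mem hq), (l.map Prod.snd).prod,
      ⟨h1.2, fun q hq => h2 q (List.mem_cons_of_mem _ hq), rfl⟩, ?_⟩
    rw [← h3, List.map_cons, List.prod_cons]
  · rintro ⟨h1, h2, h3, m', h4, rfl⟩
    exact (IsDecomposition.singleton h1 h2).append h4 (by simpa using h3)

theorem IsDecomposition.mem {m : M} {l : List (K × M)} (h : IsDecomposition G m l)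
    {P : Submonoid M} (hP : ∀ p ∈ l, G p.1 ≤ P) : m ∈ P := by
  rw [← h.2.2]
  apply Submonoid.list_prod_mem
  simp only [List.mem_map]
  rintro _ ⟨p, hp, rfl⟩
  exact hP p hp (h.2.1 p hp).1

theorem uniqueDec_of_isFactorization (h1 : ∀ a b : M, a * b = 1 → a = 1)
    (hG : IsFactorization ⊤ G) : UniqueDec G := by
  intro m
  by_cases hm : m = 1
  · subst hm
    refine ⟨[], IsDecomposition.nil, fun l hl => ?_⟩
    cases l with
    | nil => rfl
    | cons p l =>
      obtain ⟨-, h, -, m', -, he⟩ := isDecomposition_cons.1 hl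
      exact absurd (h1 _ _ he.symm) h
  · exact hG.2 m trivial hm

theorem UniqueDec.isFactorization (hG : UniqueDec G) : IsFactorization ⊤ G :=
  ⟨fun _ => le_top, fun m _ _ => hG m⟩

theorem IsSegment.le {S : Set K} {P : Submonoid M} (hP : IsSegment G S P) {k : K} (hk : k ∈ S) :
    G k ≤ P := by
  intro x hx
  by_cases h1 : x = 1
  · rw [h1]; exact one_mem P
  · exact (hP x).2 ⟨_, IsDecomposition.singleton hx h1, by simpa using hk⟩

theorem IsSegment.mono {S S' : Set K} {P P' : Submonoid M} (h : IsSegment G S P)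
    (h' : IsSegment G S' P') (hS : S ⊆ S') : P ≤ P' := by
  intro m hm
  obtain ⟨l, hl, hlS⟩ := (h m).1 hm
  exact (h' m).2 ⟨l, hl, fun p hp => hS (hlS p hp)⟩

theorem UniqueDec.inf (hG : UniqueDec G) {S S' : Set K} {P P' : Submonoid M}
    (h : IsSegment G S P) (h' : IsSegment G S' P') : IsSegment G (S ∩ S') (P ⊓ P') := by
  intro m
  constructor
  · rintro ⟨hm, hm'⟩
    obtain ⟨l, hl, hlS⟩ := (h m).1 hm
    obtain ⟨l', hl', hlS'⟩ := (h' m).1 hm'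
    obtain rfl := (hG m).unique hl hl'
    exact ⟨l, hl, fun p hp => ⟨hlS p hp, hlS' p hp⟩⟩
  · rintro ⟨l, hl, hlS⟩
    exact ⟨(h m).2 ⟨l, hl, fun p hp => (hlS p hp).1⟩, (h' m).2 ⟨l, hl, fun p hp => (hlS p hp).2⟩⟩

theorem UniqueDec.inf_eq_bot (hG : UniqueDec G) {S S' : Set K} {P P' : Submonoid M}
    (h : IsSegment G S P) (h' : IsSegment G S' P') (hd : ∀ k ∈ S, k ∉ S') : P ⊓ P' = ⊥ := by
  rw [Submonoid.eq_bot_iff_forall]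
  intro m hm
  obtain ⟨l, hl, hlS⟩ := (hG.inf h h' m).1 hm
  cases l with
  | nil => rw [← hl.2.2]; rfl
  | cons p l => exact absurd (hlS p (by simp)).2 (hd _ (hlS p (by simp)).1)

theorem IsSegment.union {S S' : Set K} {P P' Q : Submonoid M}
    (h : IsSegment G S P) (h' : IsSegment G S' P') (hlt : ∀ k ∈ S, ∀ k' ∈ S', k < k')
    (hP : P ≤ Q) (hP' : P' ≤ Q) (hQ : ∀ m ∈ Q, ∃ b ∈ P, ∃ t ∈ P', m = b * t) :
    IsSegment G (S ∪ S') Q := by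
  intro m
  constructor
  · intro hm
    obtain ⟨b, hb, t, ht, rfl⟩ := hQ m hm
    obtain ⟨l, hl, hlS⟩ := (h b).1 hb
    obtain ⟨l', hl', hlS'⟩ := (h' t).1 ht
    refine ⟨l ++ l', hl.append hl' (fun p hp q hq => hlt _ (hlS p hp) _ (hlS' q hq)), ?_⟩
    simp only [List.mem_append]
    rintro p (hp | hp)
    exacts [Or.inl (hlS p hp), Or.inr (hlS' p hp)]
  · rintro ⟨l, hl, hlS⟩
    refine hl.mem (fun p hp => ?_)
    rcases hlS p hp with hk | hk
    exacts [(h.le hk).trans hP, (h'.le hk).trans hP']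

/-- Relabelling by a strictly increasing `e` identifies decompositions along the subfamily with
decompositions along `G` supported in the range of `e`. -/
theorem UniqueDec.isFactorization_iff (hG : UniqueDec G) {J : Type*} [LinearOrder J] {e : J → K}
    (he : StrictMono e) {P : Submonoid M} :
    IsFactorization P (fun j => G (e j)) ↔ IsSegment G (Set.range e) P := by
  have key : ∀ m (l : List (J × M)), IsDecomposition (fun j => G (e j)) m l ↔
      IsDecomposition G m (l.map (Prod.map e id)) := by
    intro m l
    simp only [IsDecomposition, List.map_map, List.pairwise_map, List.forall_mem_map,
      Function.comp_def, Prod.map_fst, Prod.map_snd, id_eq, he.lt_iff_lt]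
  have hlift : ∀ l : List (K × M), (∀ p ∈ l, p.1 ∈ Set.range e) →
      ∃ l₀ : List (J × M), l = l₀.map (Prod.map e id) := by
    intro l
    induction l with
    | nil => exact fun _ => ⟨[], rfl⟩
    | cons p l ih =>
      intro h
      obtain ⟨l₀, rfl⟩ := ih (fun q hq => h q (List.mem_cons_of_mem _ hq))
      obtain ⟨j, hj⟩ := h p (by simp)
      exact ⟨(j, p.2) :: l₀, by simp [hj]⟩
  have hinj : Function.Injective (List.map (Prod.map e (id : M → M))) :=
    List.map_injective_iff.2 (he.injective.prodMap Function.injective_id)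
  constructor
  · rintro ⟨hle, hex⟩ m
    constructor
    · intro hm
      by_cases h1 : m = 1
      · subst h1
        exact ⟨[], IsDecomposition.nil, by simp⟩
      · obtain ⟨l, hl, -⟩ := hex m hm h1
        refine ⟨_, (key m l).1 hl, ?_⟩
        simp only [List.mem_map]
        rintro _ ⟨p, -, rfl⟩
        exact ⟨p.1, rfl⟩
    · rintro ⟨l, hl, hlS⟩
      refine hl.mem (fun p hp => ?_)
      obtain ⟨j, hj⟩ := hlS p hp
      rw [← hj]
      exact hle j
  · intro h
    refine ⟨fun j => h.le ⟨j, rfl⟩, fun m hm _ => ?_⟩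
    obtain ⟨l, hl, hlS⟩ := (h m).1 hm
    obtain ⟨l₀, rfl⟩ := hlift l hlS
    refine ⟨l₀, (key m l₀).2 hl, fun l' hl' => hinj ?_⟩
    exact (hG m).unique ((key m l').1 hl') hl

theorem UniqueDec.fibre_iff (hG : UniqueDec G) {J : Type*} {φ : K → J} {i : J}
    {P : Submonoid M} :
    IsFactorization P (fun k : {k : K // φ k = i} => G k) ↔ IsSegment G {k | φ k = i} P := by
  have := hG.isFactorization_iff (e := fun k : {k : K // φ k = i} => (k : K))
    (fun _ _ h => h) (P := P)
  rw [this, Subtype.range_coe_subtype]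

/-! ### Passing to a coarser family along a monotone index map. -/

section Coarsen

variable {J : Type*} [LinearOrder J] {N : J → Submonoid M} {φ : K → J}

theorem exists_coarse_decomposition (h1 : ∀ a b : M, a * b = 1 → a = 1) (hφ : Monotone φ)
    (hN : ∀ j, IsSegment G {k | φ k = j} (N j)) {m : M} {l : List (K × M)}
    (hl : IsDecomposition G m l) :
    ∃ l', IsDecomposition N m l' ∧ ∀ q ∈ l', ∃ p ∈ l, φ p.1 = q.1 := by
  induction l generalizing m with
  | nil => exact ⟨[], by rw [← hl.2.2]; exact IsDecomposition.nil, by simp⟩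
  | cons p l ih =>
    obtain ⟨hp, hp1, hlt, m', hm', rfl⟩ := isDecomposition_cons.1 hl
    obtain ⟨l', hl', hsub⟩ := ih hm'
    have hpN : p.2 ∈ N (φ p.1) := (hN _).le (k := p.1) rfl hp
    have hle : ∀ q ∈ l', φ p.1 ≤ q.1 := by
      intro q hq
      obtain ⟨r, hr, hrq⟩ := hsub q hq
      rw [← hrq]
      exact hφ (hlt r hr).le
    -- Either `p` opens a new block or its value is multiplied into the first block of `l'`; by `h1`
    -- the product stays nontrivial.
    by_cases hlt' : ∀ q ∈ l', φ p.1 < q.1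
    · refine ⟨(φ p.1, p.2) :: l', isDecomposition_cons.2 ⟨hpN, hp1, hlt', m', hl', rfl⟩, ?_⟩
      simp only [List.mem_cons]
      rintro q (rfl | hq)
      · exact ⟨p, Or.inl rfl, rfl⟩
      · obtain ⟨r, hr, hrq⟩ := hsub q hq
        exact ⟨r, Or.inr hr, hrq⟩
    · cases l' with
      | nil => simp at hlt'
      | cons q l' =>
        obtain ⟨hq, hq1, hltq, m'', hm'', rfl⟩ := isDecomposition_cons.1 hl'
        have heq : φ p.1 = q.1 := by
          refine (hle q (by simp)).eq_of_not_lt (fun hlt'' => hlt' ?_)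
          simp only [List.mem_cons]
          rintro r (rfl | hr)
          exacts [hlt'', hlt''.trans (hltq r hr)]
        refine ⟨(q.1, p.2 * q.2) :: l', isDecomposition_cons.2 ⟨mul_mem (heq ▸ hpN) hq,
          fun h => hp1 (h1 _ _ h), hltq, m'', hm'', (mul_assoc _ _ _).symm⟩, ?_⟩
        simp only [List.mem_cons]
        rintro r (rfl | hr)
        · exact ⟨p, Or.inl rfl, heq⟩
        · obtain ⟨s, hs, hsr⟩ := hsub r (List.mem_cons_of_mem _ hr)
          exact ⟨s, Or.inr hs, hsr⟩

open Classical in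
-- Concatenates the decompositions of the terms. The two extra clauses let the coarse decomposition
-- be recovered from the fine one, which yields uniqueness in `UniqueDec.coarsen`.
theorem exists_fine_decomposition (hφ : Monotone φ)
    (hN : ∀ j, IsSegment G {k | φ k = j} (N j)) {m : M} {l' : List (J × M)}
    (hl' : IsDecomposition N m l') :
    ∃ l, IsDecomposition G m l ∧ (∀ j, j ∈ l'.map Prod.fst ↔ ∃ p ∈ l, φ p.1 = j) ∧
      ∀ q ∈ l', q.2 = ((l.filter (fun p => φ p.1 = q.1)).map Prod.snd).prod := by
  induction l' generalizing m with
  | nil => exact ⟨[], by rw [← hl'.2.2]; exact IsDecomposition.nil, by simp, by simp⟩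
  | cons q l' ih =>
    obtain ⟨hq, hq1, hlt, m', hm', rfl⟩ := isDecomposition_cons.1 hl'
    obtain ⟨l, hl, hmem, hprod⟩ := ih hm'
    obtain ⟨lq, hlq, hlqS⟩ := (hN q.1 q.2).1 hq
    have hlqS' : ∀ p ∈ lq, φ p.1 = q.1 := hlqS
    have hgt : ∀ p ∈ l, q.1 < φ p.1 := by
      intro p hp
      obtain ⟨r, hr, hrp⟩ := List.mem_map.1 ((hmem _).2 ⟨p, hp, rfl⟩)
      rw [← hrp]
      exact hlt r hr
    refine ⟨lq ++ l, hlq.append hl (fun p hp r hr => ?_), fun j => ?_, fun r hr => ?_⟩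
    · by_contra hcon
      have := hφ (not_lt.1 hcon)
      rw [hlqS' p hp] at this
      exact absurd (hgt r hr) (not_lt.2 this)
    · have hne : ∃ p, p ∈ lq := by
        apply List.exists_mem_of_ne_nil
        rintro rfl
        exact hq1 hlq.2.2.symm
      simp only [List.map_cons, List.mem_cons, hmem, List.mem_append]
      constructor
      · rintro (rfl | ⟨p, hp, rfl⟩)
        · obtain ⟨p, hp⟩ := hne
          exact ⟨p, Or.inl hp, hlqS' p hp⟩
        · exact ⟨p, Or.inr hp, rfl⟩
      · rintro ⟨p, hp | hp, rfl⟩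
        · exact Or.inl (hlqS' p hp)
        · exact Or.inr ⟨p, hp, rfl⟩
    · rw [List.filter_append]
      rcases List.mem_cons.1 hr with rfl | hr
      · rw [List.filter_eq_self.2 (fun p hp => by simpa using hlqS' p hp),
          List.filter_eq_nil_iff.2 (fun p hp => by simpa using (hgt p hp).ne'), List.append_nil]
        exact hlq.2.2.symm
      · rw [List.filter_eq_nil_iff.2 (fun p hp => by
          simpa [hlqS' p hp] using (hlt r hr).ne), List.nil_append]
        exact hprod r hr

theorem UniqueDec.coarsen (h1 : ∀ a b : M, a * b = 1 → a = 1) (hG : UniqueDec G)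
    (hφ : Monotone φ) (hN : ∀ j, IsSegment G {k | φ k = j} (N j)) : UniqueDec N := by
  classical
  intro m
  obtain ⟨l, hl, -⟩ := hG m
  obtain ⟨l', hl', -⟩ := exists_coarse_decomposition h1 hφ hN hl
  refine ⟨l', hl', fun l'' hl'' => ?_⟩
  obtain ⟨a, ha, hamem, haprod⟩ := exists_fine_decomposition hφ hN hl'
  obtain ⟨b, hb, hbmem, hbprod⟩ := exists_fine_decomposition hφ hN hl''
  obtain rfl := (hG m).unique ha hb
  -- Both index lists are strictly increasing and have the same members.
  have hfst : l''.map Prod.fst = l'.map Prod.fst := by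
    refine List.Perm.eq_of_pairwise (le := (· < ·)) (fun x y _ _ hx hy => (lt_asymm hx hy).elim)
      hl''.1 hl'.1 ?_
    refine (List.perm_ext_iff_of_nodup (hl''.1.imp (fun h => h.ne))
      (hl'.1.imp (fun h => h.ne))).2 (fun j => ?_)
    rw [hamem, hbmem]
  have hval : ∀ L : List (J × M),
      (∀ q ∈ L, q.2 = ((a.filter (fun p => φ p.1 = q.1)).map Prod.snd).prod) →
      L = (L.map Prod.fst).map
        (fun j => (j, ((a.filter (fun p => φ p.1 = j)).map Prod.snd).prod)) := by
    intro L hL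
    rw [List.map_map]
    conv_lhs => rw [← List.map_id L]
    exact List.map_congr_left (fun q hq => Prod.ext rfl (hL q hq))
  rw [hval l'' hbprod, hval l' haprod, hfst]

theorem IsSegment.coarsen (h1 : ∀ a b : M, a * b = 1 → a = 1)
    (hφ : Monotone φ) (hN : ∀ j, IsSegment G {k | φ k = j} (N j)) {T : Set J}
    {P : Submonoid M} (hP : IsSegment G (φ ⁻¹' T) P) : IsSegment N T P := by
  intro m
  rw [hP m]
  constructor
  · rintro ⟨l, hl, hlT⟩
    obtain ⟨l', hl', hsub⟩ := exists_coarse_decomposition h1 hφ hN hl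
    refine ⟨l', hl', fun q hq => ?_⟩
    obtain ⟨p, hp, hpq⟩ := hsub q hq
    rw [← hpq]
    exact hlT p hp
  · rintro ⟨l', hl', hT⟩
    classical
    obtain ⟨l, hl, hmem, -⟩ := exists_fine_decomposition hφ hN hl'
    refine ⟨l, hl, fun p hp => ?_⟩
    obtain ⟨q, hq, hqp⟩ := List.mem_map.1 ((hmem _).2 ⟨p, hp, rfl⟩)
    rw [Set.mem_preimage, ← hqp]
    exact hT q hq

end Coarsen

theorem isSegment_of_isFactorization_filter (L : List (Set M)) (p : Set M → Bool)
    (hL : UniqueDec (factors L)) {P : Submonoid M}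
    (hP : IsSegment (factors L) {i | p (L.get i)} P) :
    IsFactorization P (factors (L.filter p)) := by
  have hI : (L.filter p) = ((List.finRange L.length).filter (fun i => p (L.get i))).map L.get := by
    conv_lhs => rw [← List.map_get_finRange L, List.filter_map]
    rfl
  set I := (List.finRange L.length).filter (fun i => p (L.get i)) with hIdef
  have hsorted : I.Pairwise (· < ·) := (List.pairwise_lt_finRange _).filter _
  have hlen : (L.filter p).length = I.length := by rw [hI, List.length_map]
  let e : Fin (L.filter p).length → Fin L.length := fun i => I.get (i.cast hlen)
  have he : StrictMono e := fun i j hij => by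
    exact List.pairwise_iff_get.1 hsorted _ _ (by simpa using hij)
  have hrange : Set.range e = {i | p (L.get i)} := by
    ext i
    constructor
    · rintro ⟨j, rfl⟩
      have := List.get_mem I (j.cast hlen)
      exact (List.mem_filter.1 this).2
    · intro hi
      have : i ∈ I := List.mem_filter.2 ⟨List.mem_finRange i, hi⟩
      obtain ⟨j, hj⟩ := List.mem_iff_get.1 this
      exact ⟨j.cast hlen.symm, hj⟩
  have hfac : factors (L.filter p) = fun i => factors L (e i) := by
    funext i
    simp only [factors, e]
    congr 1
    simp only [List.get_eq_getElem, hI, List.getElem_map, Fin.val_cast]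
  rw [hfac, hL.isFactorization_iff he, hrange]
  exact hP

end Segments

namespace Trace

/-! ### Labelled trees of bisections and their common refinements. -/

section Trees

variable {A : Type*} {θ : A → A → Prop} {K : Type*} [LinearOrder K]

/-- A tree of transitive bisections of `Y`, with leaves `L`, in which every node is labelled by
the set of indices of its factor with respect to `G`. -/
inductive SegTree (G : K → Submonoid (Trace θ)) :
    Set K → Set (Trace θ) → List (Set K × Set (Trace θ)) → Prop
  | leaf (S : Set K) (Y : Set (Trace θ)) : S.Nonempty →
      IsSegment G S (Submonoid.closure Y) → SegTree G S Y [(S, Y)]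
  | node (S₁ S₂ : Set K) (Y B : Set (Trace θ)) (L₁ L₂ : List (Set K × Set (Trace θ))) :
      (∀ k ∈ S₁, ∀ k' ∈ S₂, k < k') → B ⊆ Y → IsPCCode (betaIn Y B) → SegTree G S₁ B L₁ →
      SegTree G S₂ (betaIn Y B) L₂ → SegTree G (S₁ ∪ S₂) Y (L₁ ++ L₂)

/-- The list on the right is obtained by bisecting the members of the list on the left. -/
inductive Refines (G : K → Submonoid (Trace θ)) :
    List (Set K × Set (Trace θ)) → List (Set K × Set (Trace θ)) → Prop
  | nil : Refines G [] []
  | cons (p : Set K × Set (Trace θ)) (L₀ L L' : List (Set K × Set (Trace θ))) :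
      SegTree G p.1 p.2 L₀ → Refines G L L' → Refines G (p :: L) (L₀ ++ L')

variable {G : K → Submonoid (Trace θ)}

theorem SegTree.mem_iff {S : Set K} {Y : Set (Trace θ)} {L : List (Set K × Set (Trace θ))}
    (h : SegTree G S Y L) (k : K) : k ∈ S ↔ ∃ q ∈ L, k ∈ q.1 := by
  induction h with
  | leaf S Y _ _ => simp
  | node S₁ S₂ Y B L₁ L₂ _ _ _ _ _ ih₁ ih₂ =>
    simp only [Set.mem_union, ih₁, ih₂, List.mem_append, or_and_right, exists_or]

theorem SegTree.pairwise {S : Set K} {Y : Set (Trace θ)} {L : List (Set K × Set (Trace θ))}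
    (h : SegTree G S Y L) : L.Pairwise (fun p q => ∀ k ∈ p.1, ∀ k' ∈ q.1, k < k') := by
  induction h with
  | leaf S Y _ _ => simp
  | node S₁ S₂ Y B L₁ L₂ hlt _ _ h₁ h₂ ih₁ ih₂ =>
    refine List.pairwise_append.2 ⟨ih₁, ih₂, fun p hp q hq k hk k' hk' => ?_⟩
    exact hlt k ((h₁.mem_iff k).2 ⟨p, hp, hk⟩) k' ((h₂.mem_iff k').2 ⟨q, hq, hk'⟩)

theorem SegTree.leaves {S : Set K} {Y : Set (Trace θ)} {L : List (Set K × Set (Trace θ))}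
    (h : SegTree G S Y L) :
    ∀ q ∈ L, q.1.Nonempty ∧ IsSegment G q.1 (Submonoid.closure q.2) := by
  induction h with
  | leaf S Y h1 h2 => simp [h1, h2]
  | node S₁ S₂ Y B L₁ L₂ _ _ _ _ _ ih₁ ih₂ =>
    simp only [List.mem_append]
    rintro q (hq | hq)
    exacts [ih₁ q hq, ih₂ q hq]

theorem SegTree.isPCCode {S : Set K} {Y : Set (Trace θ)} {L : List (Set K × Set (Trace θ))}
    (h : SegTree G S Y L) (hY : IsPCCode Y) : ∀ q ∈ L, IsPCCode q.2 := by
  induction h with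
  | leaf S Y h1 h2 => simpa
  | node S₁ S₂ Y B L₁ L₂ _ hB hT _ _ ih₁ ih₂ =>
    simp only [List.mem_append]
    rintro q (hq | hq)
    exacts [ih₁ (hY.mono hB) q hq, ih₂ hT q hq]

theorem SegTree.nonempty {S : Set K} {Y : Set (Trace θ)} {L : List (Set K × Set (Trace θ))}
    (h : SegTree G S Y L) : S.Nonempty := by
  induction h with
  | leaf S Y h1 h2 => exact h1
  | node _ _ _ _ _ _ _ _ _ _ _ ih₁ _ => exact ih₁.inl

theorem isSegment_bisection (hsymm : ∀ a b, θ a b → θ b a) (hirrefl : ∀ a, ¬ θ a a)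
    {S₁ S₂ : Set K} {Y B : Set (Trace θ)} (hY : IsPCCode Y) (hB : B ⊆ Y)
    (hlt : ∀ k ∈ S₁, ∀ k' ∈ S₂, k < k') (h₁ : IsSegment G S₁ (Submonoid.closure B))
    (h₂ : IsSegment G S₂ (Submonoid.closure (betaIn Y B))) :
    IsSegment G (S₁ ∪ S₂) (Submonoid.closure Y) :=
  h₁.union h₂ hlt (Submonoid.closure_mono hB) (closure_betaIn_le hB)
    (fun _ hm => hY.exists_bisection hsymm hirrefl hB hm)

theorem SegTree.isSegment (hsymm : ∀ a b, θ a b → θ b a) (hirrefl : ∀ a, ¬ θ a a)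
    {S : Set K} {Y : Set (Trace θ)} {L : List (Set K × Set (Trace θ))}
    (h : SegTree G S Y L) (hY : IsPCCode Y) : IsSegment G S (Submonoid.closure Y) := by
  induction h with
  | leaf S Y h1 h2 => exact h2
  | node S₁ S₂ Y B L₁ L₂ hlt hB hT _ _ ih₁ ih₂ =>
    exact isSegment_bisection hsymm hirrefl hY hB hlt (ih₁ (hY.mono hB)) (ih₂ hT)

theorem Refines.refl {L : List (Set K × Set (Trace θ))}
    (h : ∀ q ∈ L, q.1.Nonempty ∧ IsSegment G q.1 (Submonoid.closure q.2)) : Refines G L L := by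
  induction L with
  | nil => exact .nil
  | cons p L ih =>
    have hp := h p (by simp)
    exact .cons p [p] L L (.leaf p.1 p.2 hp.1 hp.2)
      (ih (fun q hq => h q (List.mem_cons_of_mem _ hq)))

theorem SegTree.refl {S : Set K} {Y : Set (Trace θ)} {L : List (Set K × Set (Trace θ))}
    (h : SegTree G S Y L) : Refines G L L := .refl h.leaves

theorem SegTree.refines {S : Set K} {Y : Set (Trace θ)} {L : List (Set K × Set (Trace θ))}
    (h : SegTree G S Y L) : Refines G [(S, Y)] L := by
  simpa using Refines.cons (S, Y) L [] [] h .nil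

theorem Refines.append {L₁ L₂ L₁' L₂' : List (Set K × Set (Trace θ))} (h₁ : Refines G L₁ L₁')
    (h₂ : Refines G L₂ L₂') : Refines G (L₁ ++ L₂) (L₁' ++ L₂') := by
  induction h₁ with
  | nil => exact h₂
  | cons p L₀ L L' hp _ ih =>
    rw [List.append_assoc]
    exact .cons p L₀ _ _ hp ih

theorem Refines.exists_of_append {L₁ L₂ L' : List (Set K × Set (Trace θ))}
    (h : Refines G (L₁ ++ L₂) L') :
    ∃ L₁' L₂', L' = L₁' ++ L₂' ∧ Refines G L₁ L₁' ∧ Refines G L₂ L₂' := by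
  induction L₁ generalizing L' with
  | nil => exact ⟨[], L', rfl, .nil, h⟩
  | cons p L₁ ih =>
    cases h with
    | cons _ L₀ _ L' hp h =>
      obtain ⟨L₁', L₂', rfl, h₁, h₂⟩ := ih h
      exact ⟨L₀ ++ L₁', L₂', by simp, .cons p L₀ _ _ hp h₁, h₂⟩

/-- Trees are grafted at the leaves. -/
theorem SegTree.of_refines {S : Set K} {Y : Set (Trace θ)}
    {L L' : List (Set K × Set (Trace θ))} (h : SegTree G S Y L) (hL : Refines G L L') :
    SegTree G S Y L' := by
  induction h generalizing L' with
  | leaf S Y h1 h2 =>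
    cases hL with
    | cons _ L₀ _ L' hp h =>
      cases h
      simpa using hp
  | node S₁ S₂ Y B L₁ L₂ hlt hB hT _ _ ih₁ ih₂ =>
    obtain ⟨L₁', L₂', rfl, h₁, h₂⟩ := hL.exists_of_append
    exact .node S₁ S₂ Y B _ _ hlt hB hT (ih₁ h₁) (ih₂ h₂)

theorem Refines.trans {L₁ L₂ L₃ : List (Set K × Set (Trace θ))} (h : Refines G L₁ L₂)
    (h' : Refines G L₂ L₃) : Refines G L₁ L₃ := by
  induction h generalizing L₃ with
  | nil => exact h'
  | cons p L₀ L L' hp _ ih =>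
    obtain ⟨L₀', L'', rfl, h₁, h₂⟩ := h'.exists_of_append
    exact .cons p L₀' _ _ (hp.of_refines h₁) (ih h₂)

theorem Refines.exists_subset {L L' : List (Set K × Set (Trace θ))} (h : Refines G L L') :
    ∀ q ∈ L', ∃ p ∈ L, q.1 ⊆ p.1 := by
  induction h with
  | nil => simp
  | cons p L₀ L L' hp _ ih =>
    simp only [List.mem_append]
    rintro q (hq | hq)
    · exact ⟨p, by simp, fun k hk => (hp.mem_iff k).2 ⟨q, hq, hk⟩⟩
    · obtain ⟨r, hr, hqr⟩ := ih q hq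
      exact ⟨r, List.mem_cons_of_mem _ hr, hqr⟩

/-- A tree of bisections of `Y` can be refined along a bisection of `Y` into a tree of each of
its two members. -/
theorem SegTree.exists_refines_bisection (hsymm : ∀ a b, θ a b → θ b a)
    (hirrefl : ∀ a, ¬ θ a a) (hG : UniqueDec G) {S S₁ S₂ : Set K} {Y B : Set (Trace θ)}
    {F : List (Set K × Set (Trace θ))} (h : SegTree G S Y F) (hY : IsPCCode Y)
    (hS : S = S₁ ∪ S₂) (hlt : ∀ k ∈ S₁, ∀ k' ∈ S₂, k < k') (hne₁ : S₁.Nonempty)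
    (hne₂ : S₂.Nonempty) (hB : B ⊆ Y) (hT : IsPCCode (betaIn Y B))
    (h₁ : IsSegment G S₁ (Submonoid.closure B))
    (h₂ : IsSegment G S₂ (Submonoid.closure (betaIn Y B))) :
    ∃ H₁ H₂, SegTree G S₁ B H₁ ∧ SegTree G S₂ (betaIn Y B) H₂ ∧ Refines G F (H₁ ++ H₂) := by
  induction h generalizing S₁ S₂ B with
  | leaf S Y _ _ =>
    subst hS
    have t₁ := SegTree.leaf S₁ B hne₁ h₁
    have t₂ := SegTree.leaf S₂ (betaIn Y B) hne₂ h₂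
    exact ⟨_, _, t₁, t₂, (SegTree.node S₁ S₂ Y B _ _ hlt hB hT t₁ t₂).refines⟩
  | node R₁ R₂ Y B₀ F₁ F₂ hltR hB₀ hT₀ t₁ t₂ ih₁ ih₂ =>
    have hB₀c := hY.mono hB₀
    have hBc := hY.mono hB
    have s₁ := t₁.isSegment hsymm hirrefl hB₀c
    have s₂ := t₂.isSegment hsymm hirrefl hT₀
    have hmem : ∀ k, (k ∈ R₁ ∨ k ∈ R₂) ↔ (k ∈ S₁ ∨ k ∈ S₂) := fun k => Set.ext_iff.1 hS k
    have hdS : ∀ k ∈ S₁, k ∉ S₂ := fun k hk hk' => lt_irrefl _ (hlt k hk k hk')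
    have hdR : ∀ k ∈ R₁, k ∉ R₂ := fun k hk hk' => lt_irrefl _ (hltR k hk k hk')
    -- `R₁` and `S₁` are initial segments of the same set, so one contains the other.
    by_cases hRS : R₁ ⊆ S₁
    · have hBB : B₀ ⊆ B := fun x hx => hY.mem_of_mem_closure hB (hB₀ hx)
        (s₁.mono h₁ hRS (Submonoid.subset_closure hx))
      have hSR₂ : S₂ ⊆ R₂ := fun k hk => ((hmem k).2 (Or.inr hk)).resolve_left
        (fun h => hdS k (hRS h) hk)
      -- The middle label must be nonempty to be allowed in a tree. If it is empty, the two
      -- bisections coincide.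
      by_cases hne : (S₁ ∩ R₂).Nonempty
      · have hcl := hY.closure_betaIn hBB hB
        have hbb := hY.betaIn_betaIn hsymm hirrefl hBB hB hT₀
        -- The right subtree is refined along the bisection of β(B₀) into β_B(B₀) and β(B); the
        -- first part is then glued to `F₁` to form a tree of `B`.
        obtain ⟨H₁, H₂, u₁, u₂, hr⟩ := ih₂ hT₀ (S₁ := S₁ ∩ R₂) (S₂ := S₂) (B := betaIn B B₀)
          (by
            ext k
            have := hmem k
            have := @hSR₂ k
            simp only [Set.mem_union, Set.mem_inter_iff]
            tauto)
          (fun k hk => hlt k hk.1) hne hne₂ (hY.betaIn_subset hBB hB) (by rwa [hbb])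
          (by rw [hcl]; exact hG.inf h₁ s₂) (by rwa [hbb])
        rw [hbb] at u₂
        have hS₁ : S₁ = R₁ ∪ (S₁ ∩ R₂) := by
          ext k
          have := hmem k
          have := @hRS k
          simp only [Set.mem_union, Set.mem_inter_iff]
          tauto
        refine ⟨F₁ ++ H₁, H₂, ?_, u₂, ?_⟩
        · rw [hS₁]
          exact .node _ _ _ _ _ _ (fun k hk k' hk' => hltR k hk k' hk'.2) hBB
            (hT₀.mono (hY.betaIn_subset hBB hB)) t₁ u₁
        · rw [List.append_assoc]
          exact t₁.refl.append hr
      · rw [Set.not_nonempty_iff_eq_empty, Set.eq_empty_iff_forall_notMem] at hne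
        have hS₁ : R₁ = S₁ := by
          ext k
          have := hmem k
          have := @hRS k
          have := hne k
          simp only [Set.mem_inter_iff] at this
          tauto
        have hS₂ : R₂ = S₂ := by
          ext k
          have := hmem k
          have := @hSR₂ k
          have := hne k
          have := hdR k
          simp only [Set.mem_inter_iff] at *
          tauto
        subst hS₁ hS₂
        have hBB' : B ⊆ B₀ := fun x hx => hY.mem_of_mem_closure hB₀ (hB hx)
          (h₁.mono s₁ subset_rfl (Submonoid.subset_closure hx))
        obtain rfl := hBB.antisymm hBB'
        exact ⟨F₁, F₂, t₁, t₂, t₁.refl.append t₂.refl⟩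
    · obtain ⟨c, hcR, hcS⟩ := Set.not_subset.1 hRS
      have hcS₂ : c ∈ S₂ := ((hmem c).1 (Or.inl hcR)).resolve_left hcS
      have hSR : S₁ ⊆ R₁ := fun k hk => ((hmem k).2 (Or.inl hk)).resolve_right
        (fun h => lt_asymm (hlt k hk c hcS₂) (hltR c hcR k h))
      have hRS₂ : R₂ ⊆ S₂ := fun k hk => ((hmem k).1 (Or.inr hk)).resolve_left
        (fun h => hdR k (hSR h) hk)
      have hBB : B ⊆ B₀ := fun x hx => hY.mem_of_mem_closure hB₀ (hB hx)
        (h₁.mono s₁ hSR (Submonoid.subset_closure hx))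
      have hcl := hY.closure_betaIn hBB hB₀
      have hbb := hY.betaIn_betaIn hsymm hirrefl hBB hB₀ hT
      have hC : IsPCCode (betaIn B₀ B) := hT.mono (hY.betaIn_subset hBB hB₀)
      -- The mirror case: the left subtree is refined along (B, β_{B₀}(B)), and the second part is
      -- glued to `F₂` to form a tree of β(B). Here `c` shows that the middle label is nonempty.
      obtain ⟨H₁, H₂, u₁, u₂, hr⟩ := ih₁ hB₀c (S₁ := S₁) (S₂ := R₁ ∩ S₂) (B := B)
        (by
          ext k
          have := hmem k
          have := @hSR k
          simp only [Set.mem_union, Set.mem_inter_iff]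
          tauto)
        (fun k hk k' hk' => hlt k hk k' hk'.2) hne₁ ⟨c, hcR, hcS₂⟩ hBB hC h₁
        (by rw [hcl]; exact hG.inf s₁ h₂)
      have hS₂ : S₂ = (R₁ ∩ S₂) ∪ R₂ := by
        ext k
        have := hmem k
        have := @hRS₂ k
        simp only [Set.mem_union, Set.mem_inter_iff]
        tauto
      refine ⟨H₁, H₂ ++ F₂, u₁, ?_, ?_⟩
      · rw [hS₂]
        exact .node _ _ _ _ _ _ (fun k hk k' hk' => hltR k hk.1 k' hk')
          (hY.betaIn_subset hBB hB₀) (by rwa [hbb]) u₂ (by rwa [hbb])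
      · rw [← List.append_assoc]
        exact hr.append t₂.refl

/-- Two trees of bisections of `Y` have a common refinement. -/
theorem SegTree.exists_common_refinement (hsymm : ∀ a b, θ a b → θ b a)
    (hirrefl : ∀ a, ¬ θ a a) (hG : UniqueDec G) {S : Set K} {Y : Set (Trace θ)}
    {F F' : List (Set K × Set (Trace θ))} (h : SegTree G S Y F) (h' : SegTree G S Y F')
    (hY : IsPCCode Y) : ∃ Q, SegTree G S Y Q ∧ Refines G F Q ∧ Refines G F' Q := by
  induction h' generalizing F with
  | leaf S Y _ _ => exact ⟨F, h, h.refl, h.refines⟩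
  | node S₁ S₂ Y B L₁ L₂ hlt hB hT t₁ t₂ ih₁ ih₂ =>
    -- Force the top bisection of the second tree onto the first, then merge separately in the two
    -- halves.
    obtain ⟨H₁, H₂, u₁, u₂, hr⟩ := h.exists_refines_bisection hsymm hirrefl hG hY rfl hlt
      t₁.nonempty t₂.nonempty hB hT (t₁.isSegment hsymm hirrefl (hY.mono hB))
      (t₂.isSegment hsymm hirrefl hT)
    obtain ⟨Q₁, q₁, r₁, r₁'⟩ := ih₁ u₁ (hY.mono hB)
    obtain ⟨Q₂, q₂, r₂, r₂'⟩ := ih₂ u₂ hT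
    exact ⟨Q₁ ++ Q₂, .node S₁ S₂ Y B _ _ hlt hB hT q₁ q₂, hr.trans (r₁.append r₂),
      r₁'.append r₂'⟩

end Trees

/-! ### From compositions of bisections to trees and back. -/

section Composition

variable {A : Type*} {θ : A → A → Prop}

theorem IsComposedOfTransitiveBisections.isPCCode {Y : Set (Trace θ)} {L : List (Set (Trace θ))}
    (h : IsComposedOfTransitiveBisections Y L) (hY : IsPCCode Y) : ∀ X ∈ L, IsPCCode X := by
  induction h with
  | trivial => simpa
  | comp L₁ L₂ X B _ hT ih =>
    have hX := ih X (by simp)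
    simp only [List.mem_append, List.mem_cons]
    rintro Z (hZ | rfl | rfl | hZ)
    · exact ih Z (by simp [hZ])
    · exact hX.mono (Subtype.coe_image_subset X B)
    · exact (hX.image_iff _).2 hT
    · exact ih Z (by simp [hZ])

theorem IsComposedOfTransitiveBisections.trans {Y X : Set (Trace θ)}
    {L₁ L₂ L : List (Set (Trace θ))} (h : IsComposedOfTransitiveBisections Y (L₁ ++ X :: L₂))
    (h' : IsComposedOfTransitiveBisections X L) :
    IsComposedOfTransitiveBisections Y (L₁ ++ L ++ L₂) := by
  induction h' with
  | trivial => simpa using h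
  | comp L₁' L₂' Z B _ hT ih =>
    have := IsComposedOfTransitiveBisections.comp (L₁ ++ L₁') (L₂' ++ L₂) Z B
      (by simpa using ih) hT
    simpa using this

theorem IsComposedOfTransitiveBisections.bisection {Y B : Set (Trace θ)} (hY : IsPCCode Y)
    (hB : B ⊆ Y) (hT : IsPCCode (betaIn Y B)) :
    IsComposedOfTransitiveBisections Y [B, betaIn Y B] := by
  have he : Subtype.val '' {x : Y | (x : Trace θ) ∈ B} = B := by
    rw [← subHom_image_letter, ← exists_image_letter hB]
  have := IsComposedOfTransitiveBisections.comp (Y := Y) [] [] Y {x : Y | (x : Trace θ) ∈ B}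
    .trivial ((hY.isTFSA_iff _).2 (by rwa [he]))
  rw [hY.image_beta, he] at this
  exact this

theorem betaIn_empty {Y : Set (Trace θ)} (hY : IsPCCode Y) : betaIn Y ∅ = Y := by
  rw [hY.betaIn_eq (Set.empty_subset Y)]
  conv_rhs => rw [← subHom_image_letters Y]
  congr 1
  ext t
  constructor
  · rintro ⟨z, -, w, hw, rfl, -⟩
    rw [mem_closure_letter] at hw
    have hw1 : w = 1 := by
      by_contra hne
      obtain ⟨a, u, rfl⟩ := exists_letter_of_ne_one hne
      exact (hw (by simp : a ∈ alph (letter (indep Y) a * u))).elim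
    exact ⟨z, by rw [hw1, mul_one]⟩
  · rintro ⟨z, rfl⟩
    refine ⟨z, fun h => h.elim, 1, one_mem _, (mul_one _).symm, ?_⟩
    refine Set.eq_singleton_iff_unique_mem.2 ⟨⟨1, (mul_one _).symm⟩, fun c hc => ?_⟩
    simpa using IA_subset_alph _ hc

theorem betaIn_self {M : Type*} [Monoid M] (Y : Set M) : betaIn Y Y = ∅ := by
  rw [Set.eq_empty_iff_forall_notMem]
  rintro _ ⟨z, hz, hz', -⟩
  exact hz' hz

/-- Uses the trivial bisection (∅, Y). Empty factors have to be accommodated because a restriction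
keeps every trivial factor. -/
theorem IsComposedOfTransitiveBisections.replicate_left {Y : Set (Trace θ)}
    {L : List (Set (Trace θ))} (hY : IsPCCode Y) (h : IsComposedOfTransitiveBisections Y L)
    (n : ℕ) : IsComposedOfTransitiveBisections Y (List.replicate n ∅ ++ L) := by
  induction n with
  | zero => simpa using h
  | succ n ih =>
    have hb := IsComposedOfTransitiveBisections.bisection hY (Set.empty_subset Y)
      (by rwa [betaIn_empty hY])
    rw [betaIn_empty hY] at hb
    simpa [List.replicate_succ] using
      IsComposedOfTransitiveBisections.trans (L₁ := [∅]) (L₂ := []) hb ih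

theorem IsComposedOfTransitiveBisections.replicate_right {Y : Set (Trace θ)}
    {L : List (Set (Trace θ))} (hY : IsPCCode Y) (h : IsComposedOfTransitiveBisections Y L)
    (n : ℕ) : IsComposedOfTransitiveBisections Y (L ++ List.replicate n ∅) := by
  induction n with
  | zero => simpa using h
  | succ n ih =>
    have hb := IsComposedOfTransitiveBisections.bisection hY subset_rfl
      (by rw [betaIn_self]; exact isPCCode_empty)
    rw [betaIn_self] at hb
    simpa [List.replicate_succ'] using
      IsComposedOfTransitiveBisections.trans (L₁ := []) (L₂ := [∅]) hb ih

variable {K : Type*} [LinearOrder K] {G : K → Submonoid (Trace θ)}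

theorem SegTree.isComposed {S : Set K} {Y : Set (Trace θ)} {L : List (Set K × Set (Trace θ))}
    (h : SegTree G S Y L) (hY : IsPCCode Y) :
    IsComposedOfTransitiveBisections Y (L.map Prod.snd) := by
  induction h with
  | leaf S Y _ _ => exact .trivial
  | node S₁ S₂ Y B L₁ L₂ _ hB hT _ _ ih₁ ih₂ =>
    have hb := IsComposedOfTransitiveBisections.bisection hY hB hT
    have h1 := IsComposedOfTransitiveBisections.trans (L₁ := []) (L₂ := [betaIn Y B]) hb
      (ih₁ (hY.mono hB))
    have h2 := IsComposedOfTransitiveBisections.trans (L₁ := L₁.map Prod.snd) (L₂ := [])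
      (by simpa using h1) (ih₂ hT)
    simpa using h2

/-- Undo the last bisection: its two members merge into `X` with the union of their labels, which is
again a segment. Induction gives a tree with `X` as a leaf, and splitting that leaf restores `P`. -/
theorem IsComposedOfTransitiveBisections.exists_segTree (hsymm : ∀ a b, θ a b → θ b a)
    (hirrefl : ∀ a, ¬ θ a a) {Y : Set (Trace θ)} {L : List (Set (Trace θ))}
    (h : IsComposedOfTransitiveBisections Y L) (hY : IsPCCode Y)
    (P : List (Set K × Set (Trace θ))) (hPL : P.map Prod.snd = L)
    (hP : ∀ q ∈ P, q.1.Nonempty ∧ IsSegment G q.1 (Submonoid.closure q.2))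
    (hlt : P.Pairwise (fun p q => ∀ k ∈ p.1, ∀ k' ∈ q.1, k < k')) : ∃ S, SegTree G S Y P := by
  induction h generalizing P with
  | trivial =>
    obtain ⟨q, rfl, rfl⟩ := List.map_eq_singleton_iff.1 hPL
    have := hP q (by simp)
    exact ⟨q.1, .leaf q.1 q.2 this.1 this.2⟩
  | comp L₁ L₂ X B hc hT ih =>
    have hX := hc.isPCCode hY X (by simp)
    rw [hX.image_beta] at hPL
    have hT' := (hX.isTFSA_iff B).1 hT
    have hB := Subtype.coe_image_subset X B
    obtain ⟨P₁, R, rfl, rfl, hR⟩ := List.map_eq_append_iff.1 hPL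
    obtain ⟨p, R', rfl, hp, hR'⟩ := List.map_eq_cons_iff.1 hR
    obtain ⟨q, P₂, rfl, hq, rfl⟩ := List.map_eq_cons_iff.1 hR'
    rw [← hp] at hB hT' hq
    have hp' := hP p (by simp)
    have hq' := hP q (by simp)
    rw [List.pairwise_append, List.pairwise_cons, List.pairwise_cons] at hlt
    obtain ⟨l1, ⟨l2, l3, l4⟩, l5⟩ := hlt
    have hpq := l2 q (by simp)
    have hseg := isSegment_bisection hsymm hirrefl hX hB hpq hp'.2 (by rw [← hq]; exact hq'.2)
    obtain ⟨S, hS⟩ := ih (P₁ ++ (p.1 ∪ q.1, X) :: P₂) (by simp) (by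
        simp only [List.mem_append, List.mem_cons]
        rintro r (hr | rfl | hr)
        · exact hP r (by simp [hr])
        · exact ⟨hp'.1.inl, hseg⟩
        · exact hP r (by simp [hr]))
      (by
        rw [List.pairwise_append, List.pairwise_cons]
        refine ⟨l1, ⟨?_, l4⟩, ?_⟩
        · rintro r hr k (hk | hk)
          · exact l2 r (by simp [hr]) k hk
          · exact l3 r hr k hk
        · simp only [List.mem_cons]
          rintro r hr s (rfl | hs) k hk k' hk'
          · rcases hk' with hk' | hk'
            · exact l5 r hr p (by simp) k hk k' hk'
            · exact l5 r hr q (by simp) k hk k' hk'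
          · exact l5 r hr s (by simp [hs]) k hk k' hk')
    refine ⟨S, hS.of_refines ?_⟩
    have hnode : SegTree G (p.1 ∪ q.1) X ([p] ++ [q]) :=
      .node p.1 q.1 X p.2 [p] [q] hpq hB hT' (.leaf p.1 p.2 hp'.1 hp'.2)
        (by rw [← hq]; exact .leaf q.1 q.2 hq'.1 hq'.2)
    exact (Refines.refl (fun r hr => hP r (by simp [hr]))).append
      (.cons (p.1 ∪ q.1, X) _ _ _ hnode (Refines.refl (fun r hr => hP r (by simp [hr]))))

end Composition

end Trace

/-! ### Index maps between families. -/

section Finer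

variable {M : Type*} [Monoid M] {K : Type*} [LinearOrder K] {G : K → Submonoid M}

/-- The index map of a list of factors labelled by consecutive segments. -/
theorem exists_index_map (Q : List (Set K × Set M)) (hcov : ∀ k, ∃ q ∈ Q, k ∈ q.1)
    (hQ : ∀ q ∈ Q, q.1.Nonempty ∧ IsSegment G q.1 (Submonoid.closure q.2))
    (hlt : Q.Pairwise (fun p q => ∀ k ∈ p.1, ∀ k' ∈ q.1, k < k')) :
    ∃ φ : K → Fin (Q.map Prod.snd).length, Monotone φ ∧ Function.Surjective φ ∧
      (∀ k, ∃ q ∈ Q, ∀ k', φ k' = φ k ↔ k' ∈ q.1) ∧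
      ∀ i, IsSegment G {k | φ k = i} (factors (Q.map Prod.snd) i) := by
  have hlen : (Q.map Prod.snd).length = Q.length := List.length_map _
  have hex : ∀ k, ∃ i : Fin (Q.map Prod.snd).length, k ∈ (Q.get (i.cast hlen)).1 := by
    intro k
    obtain ⟨q, hq, hk⟩ := hcov k
    obtain ⟨i, rfl⟩ := List.mem_iff_get.1 hq
    exact ⟨i.cast hlen.symm, hk⟩
  have hlt' : ∀ i j : Fin (Q.map Prod.snd).length, i < j →
      ∀ k ∈ (Q.get (i.cast hlen)).1, ∀ k' ∈ (Q.get (j.cast hlen)).1, k < k' := fun i j hij =>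
    List.pairwise_iff_get.1 hlt _ _ (by simpa using hij)
  choose φ hφ using hex
  have hiff : ∀ k i, φ k = i ↔ k ∈ (Q.get (i.cast hlen)).1 := by
    refine fun k i => ⟨fun h => h ▸ hφ k, fun h => ?_⟩
    rcases lt_trichotomy (φ k) i with h' | h' | h'
    · exact absurd (hlt' _ _ h' k (hφ k) k h) (lt_irrefl k)
    · exact h'
    · exact absurd (hlt' _ _ h' k h k (hφ k)) (lt_irrefl k)
  refine ⟨φ, fun k k' hk => ?_, fun i => ?_, fun k => ?_, fun i => ?_⟩
  · by_contra hcon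
    exact absurd (hlt' _ _ (not_le.1 hcon) k' (hφ k') k (hφ k)) (not_lt.2 hk)
  · obtain ⟨k, hk⟩ := (hQ _ (List.get_mem Q (i.cast hlen))).1
    exact ⟨k, (hiff k i).2 hk⟩
  · exact ⟨_, List.get_mem Q _, fun k' => hiff k' _⟩
  · have h1 : {k | φ k = i} = (Q.get (i.cast hlen)).1 := Set.ext (fun k => hiff k i)
    have h2 : factors (Q.map Prod.snd) i = Submonoid.closure (Q.get (i.cast hlen)).2 := by
      simp [factors]
    rw [h1, h2]
    exact (hQ _ (List.get_mem Q _)).2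

/-- If the fibres of `φ` are contained in those of `φ₀`, then `φ` gives the finer family. -/
theorem exists_factor_map {J J₀ : Type*} [LinearOrder J] [LinearOrder J₀] {φ : K → J}
    {φ₀ : K → J₀} (hφ : Monotone φ) (hs : Function.Surjective φ) (hφ₀ : Monotone φ₀)
    (hs₀ : Function.Surjective φ₀) (hle : ∀ k k', φ k = φ k' → φ₀ k = φ₀ k') :
    ∃ ψ : J → J₀, Monotone ψ ∧ Function.Surjective ψ ∧ ∀ k, ψ (φ k) = φ₀ k := by
  choose g hg using hs
  have hψ : ∀ k, φ₀ (g (φ k)) = φ₀ k := fun k => hle _ _ (hg _)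
  refine ⟨fun j => φ₀ (g j), fun i j hij => ?_, fun j => ?_, hψ⟩
  · rcases hij.eq_or_lt with rfl | hlt
    · exact le_rfl
    · refine hφ₀ (not_lt.1 fun h => ?_)
      have := hφ h.le
      rw [hg, hg] at this
      exact absurd hlt (not_lt.2 this)
  · obtain ⟨k, rfl⟩ := hs₀ j
    exact ⟨φ k, hψ k⟩

end Finer

namespace Trace

/-! ### Restricting a refinement to one factor. -/

section Restriction

variable {A : Type*} {θ : A → A → Prop} {K : Type*} [LinearOrder K]
  {G : K → Submonoid (Trace θ)}

/-- The restriction keeps the leaves below `p`. Any other factor that it keeps has a label disjoint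
from `p.1`, so it generates the trivial submonoid and, being a code, is empty; such factors come
from trivial bisections. -/
theorem Refines.isComposed_restrictTo (hsymm : ∀ a b, θ a b → θ b a)
    (hirrefl : ∀ a, ¬ θ a a) (hG : UniqueDec G) {P Q : List (Set K × Set (Trace θ))}
    (h : Refines G P Q) (hQ : ∀ q ∈ Q, IsSegment G q.1 (Submonoid.closure q.2))
    (hlt : Q.Pairwise (fun p q => ∀ k ∈ p.1, ∀ k' ∈ q.1, k < k'))
    (hcode : ∀ q ∈ Q, IsPCCode q.2) {p : Set K × Set (Trace θ)} (hp : p ∈ P)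
    (hpc : IsPCCode p.2) :
    IsComposedOfTransitiveBisections p.2
      (restrictTo (Q.map Prod.snd) (Submonoid.closure p.2)) := by
  classical
  obtain ⟨P₁, P₂, rfl⟩ := List.append_of_mem hp
  obtain ⟨Q₁, R, rfl, -, hR⟩ := h.exists_of_append
  cases hR with
  | cons _ L₀ _ Q₂ ht _ =>
  have hseg := ht.isSegment hsymm hirrefl hpc
  rw [List.pairwise_append, List.pairwise_append] at hlt
  obtain ⟨-, ⟨-, -, hlt₂⟩, hlt₁⟩ := hlt
  have htriv : ∀ q ∈ Q₁ ++ (L₀ ++ Q₂), (∀ k ∈ p.1, k ∉ q.1) →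
      Submonoid.closure q.2 ≤ Submonoid.closure p.2 → q.2 = ∅ := by
    intro q hq hd hle
    apply (hcode q hq).eq_empty_of_closure
    rw [← hG.inf_eq_bot hseg (hQ q hq) hd]
    exact (inf_eq_right.2 hle).symm
  have hd₁ : ∀ q ∈ Q₁, ∀ k ∈ p.1, k ∉ q.1 := by
    intro q hq k hk hkq
    obtain ⟨r, hr, hkr⟩ := (ht.mem_iff k).1 hk
    exact lt_irrefl k (hlt₁ q hq r (by simp [hr]) k hkq k hkr)
  have hd₂ : ∀ q ∈ Q₂, ∀ k ∈ p.1, k ∉ q.1 := by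
    intro q hq k hk hkq
    obtain ⟨r, hr, hkr⟩ := (ht.mem_iff k).1 hk
    exact lt_irrefl k (hlt₂ r hr q hq k hkr k hkq)
  have hrep : ∀ Q' : List (Set K × Set (Trace θ)), (∀ q ∈ Q', q ∈ Q₁ ++ (L₀ ++ Q₂)) →
      (∀ q ∈ Q', ∀ k ∈ p.1, k ∉ q.1) →
      ∃ n, (Q'.map Prod.snd).filter (fun Y => Submonoid.closure Y ≤ Submonoid.closure p.2) =
        List.replicate n ∅ := by
    intro Q' hQ' hd
    refine ⟨_, List.eq_replicate_iff.2 ⟨rfl, fun Y hY => ?_⟩⟩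
    obtain ⟨hY, hle⟩ := List.mem_filter.1 hY
    obtain ⟨q, hq, rfl⟩ := List.mem_map.1 hY
    exact htriv q (hQ' q hq) (hd q hq) (by simpa using hle)
  obtain ⟨n₁, hn₁⟩ := hrep Q₁ (fun q hq => by simp [hq]) hd₁
  obtain ⟨n₂, hn₂⟩ := hrep Q₂ (fun q hq => by simp [hq]) hd₂
  have hL₀ : (L₀.map Prod.snd).filter
      (fun Y => Submonoid.closure Y ≤ Submonoid.closure p.2) = L₀.map Prod.snd := by
    refine List.filter_eq_self.2 (fun Y hY => ?_)
    obtain ⟨q, hq, rfl⟩ := List.mem_map.1 hY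
    have := (hQ q (by simp [hq])).mono hseg (fun k hk => (ht.mem_iff k).2 ⟨q, hq, hk⟩)
    simpa using this
  have hres : restrictTo ((Q₁ ++ (L₀ ++ Q₂)).map Prod.snd) (Submonoid.closure p.2) =
      List.replicate n₁ ∅ ++ (L₀.map Prod.snd ++ List.replicate n₂ ∅) := by
    rw [List.map_append, List.map_append, ← hn₁, ← hn₂, ← hL₀]
    simp only [restrictTo, List.filter_append, List.filter_filter, Bool.and_self]
  rw [hres]
  exact ((ht.isComposed hpc).replicate_right hpc n₂).replicate_left hpc n₁

end Restriction

end Trace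

/-! ### The proposition. -/

theorem mainTheorem7 {A : Type*} (θ : A → A → Prop)
    (hsymm : ∀ a b, θ a b → θ b a) (hirrefl : ∀ a, ¬ θ a a)
    (F F' : List (Set (Trace θ)))
    (hF : Trace.IsTransitiveFactorization (Trace.letters θ) F)
    (hF' : Trace.IsTransitiveFactorization (Trace.letters θ) F')
    {K : Type*} [LinearOrder K] (G : K → Submonoid (Trace θ))
    (hG : IsFactorization ⊤ G)
    (hFG : FinerThan (factors F) G) (hF'G : FinerThan (factors F') G) :
    ∃ G' : List (Set (Trace θ)),
      Trace.IsTransitiveFactorization (Trace.letters θ) G' ∧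
      FinerThan (factors F) (factors G') ∧
      FinerThan (factors F') (factors G') ∧
      FinerThan (factors G') G ∧
      (∀ Y ∈ F, Trace.IsTransitiveFactorization Y (restrictTo G' (Submonoid.closure Y))) ∧
      (∀ Y ∈ F', Trace.IsTransitiveFactorization Y (restrictTo G' (Submonoid.closure Y))) := by
  classical
  have h1 : ∀ a b : Trace θ, a * b = 1 → a = 1 := fun _ _ => Trace.eq_one_of_mul_eq_one
  have hU : UniqueDec G := uniqueDec_of_isFactorization h1 hG
  have hcode : Trace.IsPCCode (Trace.letters θ) := Trace.isPCCode_letters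
  -- Each factor is labelled by its fibre under the index map. The fibres cover `K`, so the root
  -- label is everything.
  have label : ∀ L : List (Set (Trace θ)), Trace.IsTransitiveFactorization (Trace.letters θ) L →
      FinerThan (factors L) G → ∃ (P : List (Set K × Set (Trace θ))) (φ : K → Fin L.length),
        P.map Prod.snd = L ∧ Monotone φ ∧ Function.Surjective φ ∧
        (∀ i, IsSegment G {k | φ k = i} (factors L i)) ∧
        (∀ p ∈ P, ∃ i, p.1 = {k | φ k = i} ∧ p.2 = L.get i) ∧
        Trace.SegTree G Set.univ (Trace.letters θ) P := by
    rintro L hL ⟨φ, hφ, hs, hfac⟩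
    have hseg : ∀ i, IsSegment G {k | φ k = i} (factors L i) := fun i =>
      hU.fibre_iff.1 (hfac i)
    let P : List (Set K × Set (Trace θ)) := List.ofFn (fun i => ({k | φ k = i}, L.get i))
    have hmem : ∀ p, p ∈ P ↔ ∃ i, ({k | φ k = i}, L.get i) = p := fun p => List.mem_ofFn
    have hPL : P.map Prod.snd = L := by
      rw [List.map_ofFn]
      exact List.ofFn_get L
    obtain ⟨S, hS⟩ := hL.2.exists_segTree (G := G) hsymm hirrefl hcode P hPL
      (by
        intro p hp
        obtain ⟨i, rfl⟩ := (hmem p).1 hp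
        exact ⟨hs i, hseg i⟩)
      (List.pairwise_ofFn.2 (fun i j hij k (hk : φ k = i) k' (hk' : φ k' = j) =>
        not_le.1 (fun h => absurd (hφ h) (by rw [hk, hk']; exact not_le.2 hij))))
    refine ⟨P, φ, hPL, hφ, hs, hseg, ?_, ?_⟩
    · intro p hp
      obtain ⟨i, rfl⟩ := (hmem p).1 hp
      exact ⟨i, rfl, rfl⟩
    · have : S = Set.univ := Set.eq_univ_iff_forall.2 (fun k =>
        (hS.mem_iff k).2 ⟨_, (hmem _).2 ⟨φ k, rfl⟩, rfl⟩)
      rwa [this] at hS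
  obtain ⟨P, φ₁, hPF, hφ₁, hs₁, hseg₁, hP₁, hPt⟩ := label F hF hFG
  obtain ⟨P', φ₂, hPF', hφ₂, hs₂, hseg₂, hP₂, hPt'⟩ := label F' hF' hF'G
  obtain ⟨Q, hQ, hr₁, hr₂⟩ := hPt.exists_common_refinement hsymm hirrefl hU hPt' hcode
  obtain ⟨φ, hφ, hs, hfib, hseg⟩ := exists_index_map (G := G) Q
    (fun k => (hQ.mem_iff k).1 trivial) hQ.leaves hQ.pairwise
  have hUQ : UniqueDec (factors (Q.map Prod.snd)) := hU.coarsen h1 hφ hseg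
  have finer : ∀ (L : List (Set (Trace θ))) (R : List (Set K × Set (Trace θ)))
      (φ₀ : K → Fin L.length), R.map Prod.snd = L → Monotone φ₀ → Function.Surjective φ₀ →
      (∀ i, IsSegment G {k | φ₀ k = i} (factors L i)) →
      (∀ p ∈ R, ∃ i, p.1 = {k | φ₀ k = i} ∧ p.2 = L.get i) →
      Trace.SegTree G Set.univ (Trace.letters θ) R → Trace.Refines G R Q →
      FinerThan (factors L) (factors (Q.map Prod.snd)) ∧
      ∀ Y ∈ L, Trace.IsTransitiveFactorization Y
        (restrictTo (Q.map Prod.snd) (Submonoid.closure Y)) := by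
    intro L R φ₀ hRL hφ₀ hs₀ hseg₀ hR hRt hr
    obtain ⟨ψ, hψ, hψs, hψφ⟩ := exists_factor_map hφ hs hφ₀ hs₀ (by
      intro k k' hkk'
      obtain ⟨q, hq, hqk⟩ := hfib k'
      obtain ⟨p, hp, hqp⟩ := hr.exists_subset q hq
      obtain ⟨i, hi, -⟩ := hR p hp
      rw [hi] at hqp
      have e₁ : φ₀ k = i := hqp ((hqk k).1 hkk')
      have e₂ : φ₀ k' = i := hqp ((hqk k').1 rfl)
      rw [e₁, e₂])
    have hsegψ : ∀ i, IsSegment (factors (Q.map Prod.snd)) {j | ψ j = i} (factors L i) := by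
      intro i
      refine IsSegment.coarsen h1 hφ hseg ?_
      have : φ ⁻¹' {j | ψ j = i} = {k | φ₀ k = i} := by
        ext k
        simp [hψφ]
      rw [this]
      exact hseg₀ i
    refine ⟨⟨ψ, hψ, hψs, fun i => hUQ.fibre_iff.2 (hsegψ i)⟩, fun Y hY => ⟨?_, ?_⟩⟩
    · obtain ⟨i, rfl⟩ := List.mem_iff_get.1 hY
      -- The filter may keep trivial factors outside the fibre of `i`, but these never occur in a
      -- decomposition, so both index sets cut out the same submonoid.
      refine isSegment_of_isFactorization_filter _ _ hUQ (fun m => ⟨fun hm => ?_, ?_⟩)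
      · obtain ⟨l, hl, hli⟩ := (hsegψ i m).1 hm
        refine ⟨l, hl, fun p hp => ?_⟩
        have : factors (Q.map Prod.snd) p.1 ≤ factors L i := (hsegψ i).le (hli p hp)
        exact decide_eq_true this
      · rintro ⟨l, hl, hli⟩
        refine hl.mem (fun p hp => ?_)
        exact of_decide_eq_true (hli p hp)
    · rw [← hRL] at hY
      obtain ⟨p, hp, rfl⟩ := List.mem_map.1 hY
      exact hr.isComposed_restrictTo hsymm hirrefl hU (fun q hq => (hQ.leaves q hq).2)
        hQ.pairwise (hQ.isPCCode hcode) hp (hRt.isPCCode hcode p hp)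
  obtain ⟨f₁, g₁⟩ := finer F P φ₁ hPF hφ₁ hs₁ hseg₁ hP₁ hPt hr₁
  obtain ⟨f₂, g₂⟩ := finer F' P' φ₂ hPF' hφ₂ hs₂ hseg₂ hP₂ hPt' hr₂
  refine ⟨Q.map Prod.snd, ⟨?_, hQ.isComposed hcode⟩, f₁, f₂,
    ⟨φ, hφ, hs, fun i => hU.fibre_iff.2 (hseg i)⟩, g₁, g₂⟩
  rw [Trace.closure_letters]
  exact hUQ.isFactorization
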